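/- Let $G=(V,E)$ be a finite simple graph, let $k$ be a field, and let $I=(x_ix_j : \{i,j\}\in E)\subseteq k[x_v : v\in V]$ be its edge ideal. Let $L=L(I)$ be the lcm-lattice of $I$, that is, the set of least common multiples of all subsets of the minimal monomial generating set of $I$, ordered by divisibility; its least element is $1$, the lcm of the empty set. Then $G$ is co-chordal (the complement of $G$ has no induced cycle of length $\ge 4$) if and only if the following two conditions both hold: 1. $L$ is $2$-degree graded: whenever $b$ covers $a$ in $L$ and $a,b\neq 1$, $\deg b=\deg a+1$, and every atom of $L$ is a monomial of degree $2$. 2. $L$ is CL-shellable: all maximal chains of $L$ have the same length and $L$ has a CL-labeling. Here a chain-edge labeling of $L$ assigns to each edge of each maximal chain of $L$ a label in some partially ordered set, in such a way that if two maximal chains coincide along their lowest $d$ edges, then their labels on these edges coincide. It is a CL-labeling if for every $x<y$ in $L$ and every maximal chain $r$ of $[1,x]$ there is exactly one maximal chain of $[x,y]$ whose sequence of labels (read from $x$ to $y$, continuing $r$) is weakly increasing, and this sequence strictly precedes lexicographically those of all other maximal chains of $[x,y]$. -/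

import Mathlib

/-! ### Posets: saturated chains, graded posets, CL-labelings -/

namespace CLShell

section Poset

variable {P : Type*} [PartialOrder P]

/-- `c` is the list of elements, from bottom to top, of a saturated (unrefinable) chain
`x = c₀ ⋖ c₁ ⋖ ⋯ ⋖ cₙ = y`, that is, of a maximal chain of the interval `[x, y]`
when `P` is finite. -/
def IsSaturatedChain (x y : P) (c : List P) : Prop :=
  c.head? = some x ∧ c.getLast? = some y ∧ c.IsChain (· ⋖ ·)

/-- A finite bounded poset is graded if all its maximal chains have the same length
(its order complex is pure). -/
def IsGraded (P : Type*) [PartialOrder P] [BoundedOrder P] : Prop :=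
  Finite P ∧ ∀ s t : Flag P, (s : Set P).ncard = (t : Set P).ncard

/-- Given a labeling `lab` of the (nontrivial) saturated chains starting at the bottom of the
poset, where `lab (r ++ [y])` is regarded as the label of the last edge of the chain `r ++ [y]`,
this is the sequence of labels that the edges of `c` receive when the chain `c` is continued
above the root `r`. Here `r` includes the starting point of the continuation and `c` does not. -/
def labelSeq {Λ : Type*} (lab : List P → Λ) : List P → List P → List Λ
  | _, [] => []
  | r, y :: c => lab (r ++ [y]) :: labelSeq lab (r ++ [y]) c

/-- Chain-lexicographic labelings of Björner and Wachs.

A chain-edge labeling attaches a label to every edge of every maximal chain, so that two maximal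
chains which agree along their lowest `d` edges have the same labels on these edges. Hence the
label of an edge `x ⋖ y` of a maximal chain `m` is a function of the part of `m` that lies between
the bottom and `y`, and it is this function that is called `lab` here.

It is a CL-labeling if for every rooted interval `[x, y]_r` (with `x < y`, and `r` a
maximal chain of `[⊥, x]`) there is exactly one maximal chain of `[x, y]` whose label sequence is
increasing, and this label sequence strictly precedes those of all the other maximal chains of
`[x, y]` in the lexicographic order. -/
def IsCLLabeling [OrderBot P] {Λ : Type*} [PartialOrder Λ] (lab : List P → Λ) : Prop :=
  ∀ (x y : P) (r : List P), x < y → IsSaturatedChain ⊥ x r →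
    ∃ c : List P, IsSaturatedChain x y c ∧
      (labelSeq lab r c.tail).IsChain (· ≤ ·) ∧
      ∀ c' : List P, IsSaturatedChain x y c' → c' ≠ c →
        ¬ (labelSeq lab r c'.tail).IsChain (· ≤ ·) ∧
        List.Lex (· < ·) (labelSeq lab r c.tail) (labelSeq lab r c'.tail)

/-- A poset is CL-shellable if it is (finite, bounded and) graded and has a CL-labeling with
labels in some poset. -/
def IsCLShellable (P : Type*) [PartialOrder P] [BoundedOrder P] : Prop :=
  IsGraded P ∧
    ∃ (Λ : Type) (_ : PartialOrder Λ) (lab : List P → Λ), IsCLLabeling lab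

end Poset

/-! ### The lcm-lattice of a monomial ideal -/

section LcmLattice

variable {σ k : Type*} [Field k]

/-- The minimal monomial generators `G(I)` of a monomial ideal `I`: the monomials in `I` that are
minimal with respect to divisibility. A monomial is represented by its exponent vector, so that
divisibility is the componentwise order, and the lcm is the componentwise maximum. -/
def minGens (I : Ideal (MvPolynomial σ k)) : Set (σ →₀ ℕ) :=
  {m | Minimal (fun u => MvPolynomial.monomial u (1 : k) ∈ I) m}

/-- The lcm-lattice `L(I)`: the least common multiples of all (finite) sets of minimal monomial
generators of `I`, ordered by divisibility. The lcm of the empty set is the monomial `1`, whose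
exponent vector is `0`. -/
def lcmLattice (I : Ideal (MvPolynomial σ k)) : Set (σ →₀ ℕ) :=
  {m | ∃ s : Finset (σ →₀ ℕ), (s : Set (σ →₀ ℕ)) ⊆ minGens I ∧ s.sup id = m}

theorem minGens_finite [Finite σ] (I : Ideal (MvPolynomial σ k)) : (minGens I).Finite := by
  have hanti : IsAntichain (· ≤ ·) (minGens I) := by
    intro a ha b hb hab hle
    exact hab (le_antisymm hle (hb.2 ha.1 hle))
  exact (WellQuasiOrderedLE.finite_of_isAntichain hanti)

theorem lcmLattice_finite [Finite σ] (I : Ideal (MvPolynomial σ k)) : (lcmLattice I).Finite := by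
  refine ((minGens_finite I).toFinset.powerset.finite_toSet.image (fun s => s.sup id)).subset ?_
  rintro m ⟨s, hs, rfl⟩
  exact ⟨s, by simpa [← Finset.coe_subset] using hs, rfl⟩

/-- The bottom of the lcm-lattice is the monomial `1`. -/
instance (I : Ideal (MvPolynomial σ k)) : OrderBot (lcmLattice I) where
  bot := ⟨0, ∅, by simp, Finset.sup_empty⟩
  bot_le a := by
    intro i
    exact Nat.zero_le _

/-- The top of the lcm-lattice is the lcm of all the minimal generators. -/
noncomputable instance [Finite σ] (I : Ideal (MvPolynomial σ k)) : OrderTop (lcmLattice I) where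
  top := ⟨(minGens_finite I).toFinset.sup id, (minGens_finite I).toFinset, by simp, rfl⟩
  le_top a := by
    obtain ⟨m, s, hs, rfl⟩ := a
    change s.sup id ≤ (minGens_finite I).toFinset.sup id
    refine Finset.sup_mono fun x hx => ?_
    simpa using hs hx

noncomputable instance [Finite σ] (I : Ideal (MvPolynomial σ k)) :
    BoundedOrder (lcmLattice I) where

/-- `L(I)` is `d`-degree graded: if `b` covers `a` in `L(I)` and `a, b ≠ 1` then
`deg b = deg a + 1`, and all the atoms of `L(I)` are monomials of degree `d`. -/
def IsDegreeGraded (I : Ideal (MvPolynomial σ k)) (d : ℕ) : Prop :=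
  (∀ a b : lcmLattice I, a ≠ ⊥ → b ≠ ⊥ → a ⋖ b →
    (b : σ →₀ ℕ).degree = (a : σ →₀ ℕ).degree + 1) ∧
  ∀ a : lcmLattice I, IsAtom a → (a : σ →₀ ℕ).degree = d

end LcmLattice

/-! ### Graphs -/

section Graph

variable {V : Type*}

/-- The edge ideal of a simple graph, in the polynomial ring whose variables are the vertices. -/
noncomputable def edgeIdeal (k : Type*) [Field k] (G : SimpleGraph V) : Ideal (MvPolynomial V k) :=
  Ideal.span {p | ∃ i j : V, G.Adj i j ∧ p = MvPolynomial.X i * MvPolynomial.X j}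

/-- A graph is chordal if it has no induced cycle of length at least four. -/
def IsChordal (G : SimpleGraph V) : Prop :=
  ∀ n : ℕ, 4 ≤ n → ¬ Nonempty (SimpleGraph.cycleGraph n ↪g G)

/-- A graph is co-chordal if its complement is chordal. -/
def IsCochordal (G : SimpleGraph V) : Prop :=
  IsChordal Gᶜ

end Graph

end CLShell

namespace CLShell

/-! The monomials in the lcm-lattice of an edge ideal are squarefree. So the lattice is the family
of vertex sets `W` whose induced subgraph in `G` has no isolated vertex, ordered by inclusion, and
degree is cardinality (`mem_range_supportEmbedding`).

Suppose the lattice is 2-degree graded with a CL-labeling. Uniqueness of increasing chains makes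
`μ(⊥, W)` a signed count of falling chains, so it is zero or has sign `(-1)` to the rank of `W`
(`IsCLLabeling.exists_moebius`), and this rank is `|W| - 1` for nonempty `W`. Möbius inversion shows
that `(-1)^|W| μ(⊥, W)` is the alternating count of independent subsets of `W`
(`sum_independent_eq`). If `W` carries an induced `n`-cycle of the complement, `n ≥ 4`, these
subsets are the cliques of the cycle and the count is `1 - n + n = 1`, which is the wrong sign.

Conversely, in a co-chordal graph Dirac's theorem orders the vertices so that every edge below `c`
has an endpoint adjacent to `c`. Then covers of elements other than `⊥` add a single vertex
(`exists_eq_insert_of_covBy`), and the edges, taken by decreasing weight, have linear quotients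
(`IsEliminationOrdering.exists_isEarly`). In a chain through the atom `e`, each later step is
labeled by the vertex it adds: first the vertices creating an edge heavier than `e`, then the other
neighbours of `e`, then the rest. The label of `e` lies between the first two groups. Above `e`,
adding the missing vertices by increasing label gives the only increasing chain
(`exists_increasing_chain`); from `⊥`, it must start with the heaviest available edge. -/

/-- A set of vertices is a union of edges if the induced subgraph has no isolated vertices. -/
def NoIsolated {V : Type*} (G : SimpleGraph V) (W : Finset V) : Prop :=
  ∀ v ∈ W, ∃ w ∈ W, G.Adj v w

/-! ### The lcm-lattice as a family of vertex sets -/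

section Support

variable {V : Type*} {k : Type*} [Field k] {G : SimpleGraph V}

theorem monomial_mem_edgeIdeal {u : V →₀ ℕ} :
    MvPolynomial.monomial u (1 : k) ∈ edgeIdeal k G ↔
      ∃ i j, G.Adj i j ∧ Finsupp.single i 1 + Finsupp.single j 1 ≤ u := by
  classical
  have h : edgeIdeal k G = Ideal.span ((fun s => MvPolynomial.monomial s (1 : k)) ''
      {m | ∃ i j, G.Adj i j ∧ m = Finsupp.single i 1 + Finsupp.single j 1}) := by
    unfold edgeIdeal
    congr 1
    ext p
    constructor
    · rintro ⟨i, j, hij, rfl⟩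
      exact ⟨_, ⟨i, j, hij, rfl⟩, by simp [MvPolynomial.X, MvPolynomial.monomial_mul]⟩
    · rintro ⟨_, ⟨i, j, hij, rfl⟩, rfl⟩
      exact ⟨i, j, hij, by simp [MvPolynomial.X, MvPolynomial.monomial_mul]⟩
  rw [h, MvPolynomial.mem_ideal_span_monomial_image]
  simp only [MvPolynomial.support_monomial, one_ne_zero, if_false, Finset.mem_singleton,
    forall_eq, Set.mem_ofPred_eq]
  constructor
  · rintro ⟨_, ⟨i, j, hij, rfl⟩, hle⟩
    exact ⟨i, j, hij, hle⟩
  · rintro ⟨i, j, hij, hle⟩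
    exact ⟨_, ⟨i, j, hij, rfl⟩, hle⟩

theorem edge_exponent_eq_of_le {i j a b : V}
    (h : Finsupp.single a 1 + Finsupp.single b 1 ≤
      (Finsupp.single i 1 + Finsupp.single j 1 : V →₀ ℕ)) :
    (Finsupp.single a 1 + Finsupp.single b 1 : V →₀ ℕ) =
      Finsupp.single i 1 + Finsupp.single j 1 := by
  obtain ⟨c, hc⟩ := exists_add_of_le h
  have hd := congrArg Finsupp.degree hc
  simp only [map_add, Finsupp.degree_single] at hd
  have : c = 0 := (Finsupp.degree_eq_zero_iff c).1 (by omega)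
  rw [hc, this, add_zero]

theorem mem_minGens_edgeIdeal {m : V →₀ ℕ} :
    m ∈ minGens (edgeIdeal k G) ↔
      ∃ i j, G.Adj i j ∧ m = Finsupp.single i 1 + Finsupp.single j 1 := by
  constructor
  · rintro ⟨hm, hmin⟩
    obtain ⟨i, j, hij, hle⟩ := monomial_mem_edgeIdeal.1 hm
    exact ⟨i, j, hij,
      le_antisymm (hmin (monomial_mem_edgeIdeal.2 ⟨i, j, hij, le_rfl⟩) hle) hle⟩
  · rintro ⟨i, j, hij, rfl⟩
    refine ⟨monomial_mem_edgeIdeal.2 ⟨i, j, hij, le_rfl⟩, fun u hu hle => ?_⟩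
    obtain ⟨a, b, -, hab⟩ := monomial_mem_edgeIdeal.1 hu
    rw [← edge_exponent_eq_of_le (hab.trans hle)]
    exact hab

theorem sup_id_apply (s : Finset (V →₀ ℕ)) (v : V) : s.sup id v = s.sup fun m => m v := by
  classical
  induction s using Finset.induction_on with
  | empty => rfl
  | insert a s _ ih => simp [Finset.sup_insert, Finsupp.sup_apply, ih]

/-- Edges join distinct vertices, so the generators are squarefree, and lcms of squarefree monomials
are squarefree. -/
theorem lcmLattice_apply_le_one (m : lcmLattice (edgeIdeal k G)) (v : V) :
    (m : V →₀ ℕ) v ≤ 1 := by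
  classical
  obtain ⟨_, s, hs, rfl⟩ := m
  simp only [sup_id_apply]
  refine Finset.sup_le fun m hm => ?_
  obtain ⟨i, j, hij, rfl⟩ := mem_minGens_edgeIdeal.1 (hs hm)
  have := hij.ne
  simp only [Finsupp.add_apply, Finsupp.single_apply]
  split_ifs <;> simp_all

theorem lcmLattice_le_iff {a b : lcmLattice (edgeIdeal k G)} :
    (a : V →₀ ℕ).support ⊆ (b : V →₀ ℕ).support ↔ a ≤ b := by
  constructor
  · intro h v
    by_cases hv : v ∈ (a : V →₀ ℕ).support
    · have hb := h hv
      rw [Finsupp.mem_support_iff] at hb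
      have := lcmLattice_apply_le_one a v
      change (a : V →₀ ℕ) v ≤ (b : V →₀ ℕ) v
      omega
    · rw [Finsupp.notMem_support_iff] at hv
      omega
  · intro h v hv
    have h' : (a : V →₀ ℕ) v ≤ (b : V →₀ ℕ) v := h v
    rw [Finsupp.mem_support_iff] at hv ⊢
    omega

/-- The embedding of the lcm-lattice of an edge ideal into the lattice of sets of vertices. -/
def supportEmbedding (k : Type*) [Field k] (G : SimpleGraph V) :
    lcmLattice (edgeIdeal k G) ↪o Finset V :=
  OrderEmbedding.ofMapLEIff (fun m => (m : V →₀ ℕ).support) fun _ _ => lcmLattice_le_iff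

theorem card_supportEmbedding (m : lcmLattice (edgeIdeal k G)) :
    (supportEmbedding k G m).card = (m : V →₀ ℕ).degree := by
  rw [Finsupp.degree_apply, Finset.card_eq_sum_ones]
  refine Finset.sum_congr rfl fun v hv => ?_
  have h1 := lcmLattice_apply_le_one m v
  have h2 := Finsupp.mem_support_iff.1 hv
  omega

theorem mem_range_supportEmbedding {W : Finset V} :
    W ∈ Set.range (supportEmbedding k G) ↔ NoIsolated G W := by
  classical
  constructor
  · rintro ⟨⟨_, s, hs, rfl⟩, rfl⟩ v hv
    have hv' : v ∈ (s.sup id).support := hv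
    rw [Finsupp.mem_support_iff, sup_id_apply, ← Nat.pos_iff_ne_zero, Finset.lt_sup_iff] at hv'
    obtain ⟨m, hm, hmv⟩ := hv'
    have key : ∀ w, 0 < m w → w ∈ (s.sup id).support := fun w hw => by
      rw [Finsupp.mem_support_iff, sup_id_apply, ← Nat.pos_iff_ne_zero, Finset.lt_sup_iff]
      exact ⟨m, hm, hw⟩
    obtain ⟨i, j, hij, rfl⟩ := mem_minGens_edgeIdeal.1 (hs hm)
    by_cases hi : i = v
    · subst hi
      exact ⟨j, key j (by simp), hij⟩
    · by_cases hj : j = v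
      · subst hj
        exact ⟨i, key i (by simp), hij.symm⟩
      · simp [hi, hj] at hmv
  · intro hW
    -- The monomial with support `W` is the lcm of all the edges inside `W`.
    have hval : ∀ u : V →₀ ℕ, u ∈ ((W ×ˢ W).filter fun p => G.Adj p.1 p.2).image
        (fun p => Finsupp.single p.1 1 + Finsupp.single p.2 1) →
        ∃ i j, i ∈ W ∧ j ∈ W ∧ G.Adj i j ∧ u = Finsupp.single i 1 + Finsupp.single j 1 := by
      intro u hu
      simp only [Finset.mem_image, Finset.mem_filter, Finset.mem_product, Prod.exists] at hu
      obtain ⟨i, j, ⟨⟨hi, hj⟩, hij⟩, rfl⟩ := hu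
      exact ⟨i, j, hi, hj, hij, rfl⟩
    refine ⟨⟨_, ((W ×ˢ W).filter fun p => G.Adj p.1 p.2).image
      (fun p => Finsupp.single p.1 1 + Finsupp.single p.2 1), fun u hu => ?_, rfl⟩, ?_⟩
    · obtain ⟨i, j, -, -, hij, rfl⟩ := hval u hu
      exact mem_minGens_edgeIdeal.2 ⟨i, j, hij, rfl⟩
    · ext v
      change v ∈ Finsupp.support _ ↔ _
      rw [Finsupp.mem_support_iff, sup_id_apply, ← Nat.pos_iff_ne_zero, Finset.lt_sup_iff]
      constructor
      · rintro ⟨u, hu, huv⟩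
        obtain ⟨i, j, hi, hj, hij, rfl⟩ := hval u hu
        by_contra hv
        have h1 : i ≠ v := fun h => hv (h ▸ hi)
        have h2 : j ≠ v := fun h => hv (h ▸ hj)
        simp [h1, h2] at huv
      · intro hv
        obtain ⟨w, hw, hvw⟩ := hW v hv
        refine ⟨Finsupp.single v 1 + Finsupp.single w 1, ?_, by simp⟩
        simp only [Finset.mem_image, Finset.mem_filter, Finset.mem_product, Prod.exists]
        exact ⟨v, w, ⟨⟨hv, hw⟩, hvw⟩, rfl⟩

end Support

/-! ### Saturated chains -/

section Chains

variable {P : Type*} [PartialOrder P] {x y z : P} {c r : List P}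

theorem isSaturatedChain_cons_cons :
    IsSaturatedChain x y (x :: z :: c) ↔ x ⋖ z ∧ IsSaturatedChain z y (z :: c) := by
  simp [IsSaturatedChain, List.isChain_cons_cons, List.getLast?_cons_cons]
  tauto

theorem isSaturatedChain_singleton : IsSaturatedChain x y [x] ↔ x = y := by
  simp [IsSaturatedChain]

theorem IsSaturatedChain.exists_eq_cons (h : IsSaturatedChain x y c) : ∃ d, c = x :: d := by
  cases c with
  | nil => simp [IsSaturatedChain] at h
  | cons a d => exact ⟨d, by simpa [IsSaturatedChain] using h.1⟩

theorem IsSaturatedChain.le_of_cons : ∀ {d : List P} {x : P},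
    IsSaturatedChain x y (x :: d) → x ≤ y
  | [], _, h => (isSaturatedChain_singleton.1 h).le
  | _ :: _, _, h =>
    (isSaturatedChain_cons_cons.1 h).1.le.trans (isSaturatedChain_cons_cons.1 h).2.le_of_cons

theorem IsSaturatedChain.eq_nil {d : List P} (h : IsSaturatedChain x x (x :: d)) : d = [] := by
  cases d with
  | nil => rfl
  | cons a d =>
    obtain ⟨h1, h2⟩ := isSaturatedChain_cons_cons.1 h
    exact absurd (h1.lt.trans_le h2.le_of_cons) (lt_irrefl _)

theorem IsSaturatedChain.exists_eq_cons_cons {d : List P} (h : IsSaturatedChain x y (x :: d))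
    (hxy : x < y) : ∃ z d', d = z :: d' ∧ x ⋖ z ∧ IsSaturatedChain z y (z :: d') := by
  cases d with
  | nil => exact absurd (isSaturatedChain_singleton.1 h) hxy.ne
  | cons a d => exact ⟨a, d, rfl, isSaturatedChain_cons_cons.1 h⟩

theorem IsSaturatedChain.concat (h : IsSaturatedChain z x r) (hxy : x ⋖ y) :
    IsSaturatedChain z y (r ++ [y]) := by
  obtain ⟨d, rfl⟩ := h.exists_eq_cons
  refine ⟨by simp, List.getLast?_concat, ?_⟩
  rw [List.isChain_append]
  refine ⟨h.2.2, List.isChain_singleton _, fun a ha b hb => ?_⟩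
  rw [h.2.1] at ha
  simp only [Option.mem_def, Option.some.injEq, List.head?_cons] at ha hb
  rwa [← ha, ← hb]

end Chains

/-! ### The sign of the Möbius function under a CL-labeling -/

section Moebius

variable {P : Type*} [PartialOrder P] {Λ : Type*} [PartialOrder Λ] (lab : List P → Λ)

/-- The rooted interval `[x, y]_r` has an increasing maximal chain whose first label is at least
the last label of the root `r`. -/
def HasRise (r : List P) (x y : P) : Prop :=
  ∃ d, IsSaturatedChain x y (x :: d) ∧ (lab r :: labelSeq lab r d).IsChain (· ≤ ·)

variable {lab} {r : List P} {x y : P}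

theorem HasRise.le (h : HasRise lab r x y) : x ≤ y := by
  obtain ⟨d, hd, -⟩ := h
  exact hd.le_of_cons

theorem hasRise_self : HasRise lab r x x :=
  ⟨[], isSaturatedChain_singleton.2 rfl, by simp [labelSeq]⟩

theorem IsCLLabeling.exists_hasRise [OrderBot P] (h : IsCLLabeling lab) (hxy : x < y)
    (hr : IsSaturatedChain ⊥ x r) :
    ∃ z, x ⋖ z ∧ HasRise lab (r ++ [z]) z y ∧
      ∀ w, x ⋖ w → HasRise lab (r ++ [w]) w y → w = z := by
  obtain ⟨c, hc, hinc, huniq⟩ := h x y r hxy hr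
  obtain ⟨d, rfl⟩ := hc.exists_eq_cons
  obtain ⟨z, d, rfl, hxz, hd⟩ := hc.exists_eq_cons_cons hxy
  refine ⟨z, hxz, ⟨d, hd, hinc⟩, fun w hxw ⟨e, he, hinc'⟩ => ?_⟩
  by_contra hne
  refine (huniq (x :: w :: e) (isSaturatedChain_cons_cons.2 ⟨hxw, he⟩) ?_).1 hinc'
  simp [hne]

theorem hasRise_iff_of_lt (hxy : x < y) :
    HasRise lab r x y ↔ ∃ z, x ⋖ z ∧ lab r ≤ lab (r ++ [z]) ∧ HasRise lab (r ++ [z]) z y := by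
  constructor
  · rintro ⟨d, hd, hinc⟩
    obtain ⟨z, d, rfl, hxz, hd⟩ := hd.exists_eq_cons_cons hxy
    simp only [labelSeq, List.isChain_cons_cons] at hinc
    exact ⟨z, hxz, hinc.1, d, hd, hinc.2⟩
  · rintro ⟨z, hxz, hle, d, hd, hinc⟩
    exact ⟨z :: d, isSaturatedChain_cons_cons.2 ⟨hxz, hd⟩,
      by simpa only [labelSeq, List.isChain_cons_cons] using ⟨hle, hinc⟩⟩

variable [Fintype P]

open Classical in
/-- The number of falling continuations of the rooted chain `r` from its end `x` to `z`, counted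
with the sign of their length; `n` bounds the length. -/
noncomputable def fallingSum (lab : List P → Λ) : ℕ → List P → P → P → ℤ
  | 0, _, x, z => if x = z then 1 else 0
  | n + 1, r, x, z => (if x = z then 1 else 0) -
      ∑ w with x ⋖ w ∧ ¬ lab r ≤ lab (r ++ [w]), fallingSum lab n (r ++ [w]) w z

open Classical in
theorem card_Ioi_lt {w : P} (h : x < w) :
    (Finset.univ.filter (w < ·)).card < (Finset.univ.filter (x < ·)).card := by
  refine Finset.card_lt_card ((Finset.ssubset_iff_of_subset fun v hv => ?_).2 ⟨w, ?_, ?_⟩)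
  · simp only [Finset.mem_filter, Finset.mem_univ, true_and] at hv ⊢
    exact h.trans hv
  · simpa using h
  · simp

open Classical in
-- The bound `n` is harmless once it is at least the number of elements above `x`: when it is `0`,
-- nothing covers `x` and the sum is empty.
theorem fallingSum_eq {n : ℕ} (hn : (Finset.univ.filter (x < ·)).card ≤ n) (z : P) :
    fallingSum lab n r x z = (if x = z then 1 else 0) -
      ∑ w with x ⋖ w ∧ ¬ lab r ≤ lab (r ++ [w]), fallingSum lab (n - 1) (r ++ [w]) w z := by
  cases n with
  | succ n => rfl
  | zero =>
    rw [Finset.filter_false_of_mem, Finset.sum_empty, sub_zero, fallingSum]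
    rintro w - ⟨hw, -⟩
    have := card_Ioi_lt hw.lt
    omega

open Classical in
theorem sum_ite_hasRise [OrderBot P] (h : IsCLLabeling lab) (hr : IsSaturatedChain ⊥ x r)
    (q : P → Prop) [DecidablePred fun w => x ⋖ w ∧ q w]
    [Decidable (∃ w, x ⋖ w ∧ q w ∧ HasRise lab (r ++ [w]) w y)] :
    (∑ w with x ⋖ w ∧ q w, if HasRise lab (r ++ [w]) w y then (1 : ℤ) else 0) =
      if ∃ w, x ⋖ w ∧ q w ∧ HasRise lab (r ++ [w]) w y then 1 else 0 := by
  split_ifs with hq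
  · obtain ⟨w, hw, hqw, hrw⟩ := hq
    obtain ⟨z, -, -, huniq⟩ := h.exists_hasRise (hw.lt.trans_le hrw.le) hr
    rw [Finset.sum_eq_single w, if_pos hrw]
    · intro v hv hne
      simp only [Finset.mem_filter, Finset.mem_univ, true_and] at hv
      refine if_neg fun hrv => hne ?_
      rw [huniq v hv.1 hrv, huniq w hw hrw]
    · intro hw'
      simp [hw, hqw] at hw'
  · refine Finset.sum_eq_zero fun w hw => if_neg fun hrw => hq ?_
    simp only [Finset.mem_filter, Finset.mem_univ, true_and] at hw
    exact ⟨w, hw.1, hw.2, hrw⟩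

open Classical in
-- By induction the left side is `[x ≤ y]` minus the number of falling first steps `w` from which an
-- increasing chain reaches `y`. For `x < y` exactly one first step starts an increasing chain of
-- `[x, y]`. If it falls from the last label of `r`, the terms cancel; otherwise it extends the rise
-- and `1` remains.
theorem sum_fallingSum [OrderBot P] (h : IsCLLabeling lab) : ∀ {n : ℕ} {x : P} {r : List P},
    (Finset.univ.filter (x < ·)).card ≤ n → IsSaturatedChain ⊥ x r →
    ∑ z with z ≤ y, fallingSum lab n r x z = if HasRise lab r x y then 1 else 0 := by
  intro n
  induction n using Nat.strong_induction_on with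
  | _ n ih =>
  intro x r hn hr
  have step : ∑ z with z ≤ y, fallingSum lab n r x z = (if x ≤ y then 1 else 0) -
      if ∃ w, x ⋖ w ∧ ¬ lab r ≤ lab (r ++ [w]) ∧ HasRise lab (r ++ [w]) w y then 1 else 0 := by
    rw [Finset.sum_congr rfl fun z _ => fallingSum_eq hn z, Finset.sum_sub_distrib,
      Finset.sum_comm, ← sum_ite_hasRise h hr fun w => ¬ lab r ≤ lab (r ++ [w])]
    congr 1
    · rw [Finset.sum_ite_eq]
      simp
    · refine Finset.sum_congr rfl fun w hw => ?_
      simp only [Finset.mem_filter, Finset.mem_univ, true_and] at hw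
      have := card_Ioi_lt hw.1.lt
      exact ih (n - 1) (by omega) (by omega) (hr.concat hw.1)
  rw [step]
  by_cases hxy : x ≤ y
  · rcases hxy.eq_or_lt with rfl | hlt
    · rw [if_pos le_rfl, if_pos hasRise_self, if_neg]
      · rfl
      · rintro ⟨w, hw, -, hrw⟩
        exact absurd (hw.lt.trans_le hrw.le) (lt_irrefl _)
    · rw [if_pos hxy, hasRise_iff_of_lt hlt]
      obtain ⟨z, hz, hrz, huniq⟩ := h.exists_hasRise hlt hr
      have key : ∀ q : P → Prop, (∃ w, x ⋖ w ∧ q w ∧ HasRise lab (r ++ [w]) w y) ↔ q z :=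
        fun q => ⟨fun ⟨w, hw, hq, hrw⟩ => huniq w hw hrw ▸ hq, fun hq => ⟨z, hz, hq, hrz⟩⟩
      simp only [key fun w => ¬ lab r ≤ lab (r ++ [w]), key fun w => lab r ≤ lab (r ++ [w])]
      split_ifs <;> simp_all
  · rw [if_neg hxy, if_neg, if_neg fun hx => hxy hx.le, sub_zero]
    rintro ⟨w, hw, -, hrw⟩
    exact hxy (hw.le.trans hrw.le)

/-- All falling chains from `x` to `z` have length `ρ z - ρ x`; the exponent `ρ z + ρ x` has the
same parity and avoids subtraction. -/
theorem fallingSum_sign {ρ : P → ℕ} (hρ : ∀ a b : P, a ⋖ b → ρ b = ρ a + 1) (z : P) :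
    ∀ (n : ℕ) (r : List P) (x : P), 0 ≤ (-1) ^ (ρ z + ρ x) * fallingSum lab n r x z := by
  classical
  have hself : ∀ x, (0 : ℤ) ≤ (-1) ^ (ρ z + ρ x) * if x = z then 1 else 0 := by
    intro x
    split_ifs with h
    · rw [h, Even.neg_one_pow ⟨_, rfl⟩]
      norm_num
    · simp
  intro n
  induction n with
  | zero =>
    intro r x
    exact hself x
  | succ n ih =>
    intro r x
    rw [fallingSum, mul_sub, sub_eq_add_neg, ← mul_neg, ← Finset.sum_neg_distrib, Finset.mul_sum]
    refine add_nonneg (hself x) (Finset.sum_nonneg fun w hw => ?_)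
    simp only [Finset.mem_filter, Finset.mem_univ, true_and] at hw
    have := ih (r ++ [w]) w
    rw [hρ x w hw.1, ← add_assoc, pow_succ] at this
    linarith

open Classical in
/-- In a graded poset with a CL-labeling, the Möbius function `μ(⊥, z)` has sign `(-1) ^ ρ(z)`. -/
theorem IsCLLabeling.exists_moebius [OrderBot P] (h : IsCLLabeling lab) {ρ : P → ℕ}
    (hρ : ∀ a b : P, a ⋖ b → ρ b = ρ a + 1) (hbot : ρ ⊥ = 0) :
    ∃ μ : P → ℤ, (∀ y, ∑ z with z ≤ y, μ z = if y = ⊥ then 1 else 0) ∧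
      ∀ z, 0 ≤ (-1) ^ ρ z * μ z := by
  have hb : IsSaturatedChain ⊥ ⊥ [(⊥ : P)] := isSaturatedChain_singleton.2 rfl
  -- The root `[⊥]` has no last edge, so every atom is allowed as a first step; `True` stands in for
  -- the falling condition.
  refine ⟨fun z => (if ⊥ = z then 1 else 0) - ∑ w with ⊥ ⋖ w ∧ True,
    fallingSum lab (Fintype.card P) ([⊥] ++ [w]) w z, fun y => ?_, fun z => ?_⟩
  · have : ∀ w ∈ Finset.univ.filter fun w : P => ⊥ ⋖ w ∧ True,
        ∑ z with z ≤ y, fallingSum lab (Fintype.card P) ([⊥] ++ [w]) w z =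
          if HasRise lab ([⊥] ++ [w]) w y then 1 else 0 := by
      intro w hw
      simp only [Finset.mem_filter, Finset.mem_univ, true_and] at hw
      exact sum_fallingSum h (Finset.card_le_univ _) (hb.concat hw.1)
    rw [Finset.sum_sub_distrib, Finset.sum_comm, Finset.sum_congr rfl this,
      sum_ite_hasRise h hb fun _ => True, Finset.sum_ite_eq, if_pos (by simp)]
    split_ifs with h1 h2 h2
    · obtain ⟨w, hw, -, hrw⟩ := h1
      exact absurd (hw.lt.trans_le hrw.le) (h2 ▸ lt_irrefl _)
    · rfl
    · rfl
    · obtain ⟨w, hw, hrw, -⟩ := h.exists_hasRise (bot_lt_iff_ne_bot.2 h2) hb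
      exact absurd ⟨w, hw, trivial, hrw⟩ h1
  · rw [mul_sub, sub_eq_add_neg, ← mul_neg, ← Finset.sum_neg_distrib, Finset.mul_sum]
    refine add_nonneg ?_ (Finset.sum_nonneg fun w hw => ?_)
    · split_ifs with hz
      · simp [← hz, hbot]
      · simp
    · simp only [Finset.mem_filter, Finset.mem_univ, true_and] at hw
      have := fallingSum_sign (lab := lab) hρ z (Fintype.card P) ([⊥] ++ [w]) w
      rw [hρ _ w hw.1, hbot, zero_add, pow_succ] at this
      linarith

end Moebius

/-! ### Alternating count of the cliques of a cycle -/

theorem cycleGraph_adj_iff_val {n : ℕ} (hn : 3 ≤ n) {u v : Fin n} :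
    (SimpleGraph.cycleGraph n).Adj u v ↔ u.val + 1 = v.val ∨ v.val + 1 = u.val ∨
      (u.val = 0 ∧ v.val + 1 = n) ∨ (v.val = 0 ∧ u.val + 1 = n) := by
  obtain ⟨n, rfl⟩ : ∃ m, n = m + 3 := ⟨n - 3, by omega⟩
  rw [SimpleGraph.cycleGraph_adj', Fin.val_sub, Fin.val_sub]
  have hu := u.isLt
  have hv := v.isLt
  have key : ∀ a b : ℕ, a < n + 3 → b < n + 3 →
      ((n + 3 - b + a) % (n + 3) = 1 ↔ b + 1 = a ∨ (a = 0 ∧ b + 1 = n + 3)) := by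
    intro a b ha hb
    by_cases h : b ≤ a
    · rw [show n + 3 - b + a = (a - b) + (n + 3) by omega, Nat.add_mod_right,
        Nat.mod_eq_of_lt (by omega)]
      omega
    · rw [Nat.mod_eq_of_lt (by omega)]
      omega
  rw [key _ _ hu hv, key _ _ hv hu]
  tauto

/-- The successor of a vertex of the cycle graph. -/
def cycleNext {n : ℕ} (i : Fin n) : Fin n :=
  ⟨if i.val + 1 < n then i.val + 1 else 0, by have := i.isLt; split_ifs <;> omega⟩

theorem cycleNext_val {n : ℕ} (i : Fin n) :
    (i.val + 1 < n ∧ (cycleNext i).val = i.val + 1) ∨ (i.val + 1 = n ∧ (cycleNext i).val = 0) := by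
  have := i.isLt
  simp only [cycleNext]
  split_ifs <;> omega

theorem isClique_cycleGraph_iff {n : ℕ} (hn : 4 ≤ n) (T : Finset (Fin n)) :
    (SimpleGraph.cycleGraph n).IsClique (T : Set (Fin n)) ↔
      T = ∅ ∨ (∃ i, T = {i}) ∨ ∃ i, T = {i, cycleNext i} := by
  have hadj := @cycleGraph_adj_iff_val n (by omega)
  constructor
  · intro hT
    have hT' : ∀ a ∈ T, ∀ b ∈ T, a ≠ b → a.val + 1 = b.val ∨ b.val + 1 = a.val ∨
        (a.val = 0 ∧ b.val + 1 = n) ∨ (b.val = 0 ∧ a.val + 1 = n) :=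
      fun a ha b hb hab => hadj.1 (hT ha hb hab)
    rcases T.eq_empty_or_nonempty with h | ⟨i, hi⟩
    · exact Or.inl h
    right
    by_cases h1 : T = {i}
    · exact Or.inl ⟨i, h1⟩
    right
    obtain ⟨j, hj, hji⟩ : ∃ j ∈ T, j ≠ i := by
      by_contra hcon
      push Not at hcon
      exact h1 (Finset.eq_singleton_iff_unique_mem.2 ⟨hi, hcon⟩)
    have hpair : T = {i, j} := by
      refine Finset.Subset.antisymm (fun k hk => ?_) (by simp [Finset.insert_subset_iff, hi, hj])
      by_contra hk'
      simp only [Finset.mem_insert, Finset.mem_singleton, not_or] at hk'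
      have e1 := hT' i hi j hj (Ne.symm hji)
      have e2 := hT' k hk i hi hk'.1
      have e3 := hT' k hk j hj hk'.2
      have := hk'.1
      have := hk'.2
      simp only [ne_eq, Fin.ext_iff] at *
      omega
    have hi' := i.isLt
    have hj' := j.isLt
    by_cases h : j = cycleNext i
    · exact ⟨i, h ▸ hpair⟩
    · refine ⟨j, ?_⟩
      have : i = cycleNext j := by
        have e1 := hT' i hi j hj (Ne.symm hji)
        simp only [cycleNext, Fin.ext_iff] at *
        split_ifs at * <;> omega
      rw [← this, hpair, Finset.pair_comm]
  · rintro (rfl | ⟨i, rfl⟩ | ⟨i, rfl⟩)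
    · simp
    · simp
    · have : (SimpleGraph.cycleGraph n).Adj i (cycleNext i) := by
        rw [hadj]
        have := i.isLt
        simp only [cycleNext]
        split_ifs <;> omega
      rw [Finset.coe_pair, SimpleGraph.isClique_pair]
      exact fun _ => this

open Classical in
-- Without triangles, the cliques are the empty set, `n` vertices and `n` edges, contributing `1 - n
-- + n`.
theorem sum_cliques_cycleGraph {n : ℕ} (hn : 4 ≤ n) :
    ∑ T : Finset (Fin n), (-1 : ℤ) ^ T.card *
      (if (SimpleGraph.cycleGraph n).IsClique (T : Set (Fin n)) then 1 else 0) = 1 := by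
  have hne : ∀ i : Fin n, i ≠ cycleNext i := by
    intro i h
    rw [Fin.ext_iff] at h
    simp only [cycleNext] at h
    split_ifs at h <;> omega
  have hinj : Function.Injective fun i : Fin n => ({i, cycleNext i} : Finset (Fin n)) := by
    intro i j h
    have h' : ({i, cycleNext i} : Finset (Fin n)) = {j, cycleNext j} := h
    have h1 : i ∈ ({j, cycleNext j} : Finset (Fin n)) := h' ▸ Finset.mem_insert_self _ _
    have h2 : j ∈ ({i, cycleNext i} : Finset (Fin n)) := by
      have : j ∈ ({j, cycleNext j} : Finset (Fin n)) := Finset.mem_insert_self _ _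
      rwa [← h'] at this
    simp only [Finset.mem_insert, Finset.mem_singleton, Fin.ext_iff, cycleNext] at h1 h2 ⊢
    have := i.isLt
    have := j.isLt
    split_ifs at h1 h2 <;> omega
  have hset : (Finset.univ.filter fun T : Finset (Fin n) =>
      (SimpleGraph.cycleGraph n).IsClique (T : Set (Fin n))) =
      {∅} ∪ (Finset.univ.image fun i => {i}) ∪ Finset.univ.image fun i => {i, cycleNext i} := by
    ext T
    simp [isClique_cycleGraph_iff hn, eq_comm]
  simp only [mul_ite, mul_one, mul_zero]
  rw [← Finset.sum_filter, hset, Finset.sum_union, Finset.sum_union,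
    Finset.sum_image hinj.injOn, Finset.sum_image (Finset.singleton_injective.injOn)]
  · simp [hne]
  · simp
  · rw [Finset.disjoint_left]
    intro T hT hT'
    simp only [Finset.mem_image, Finset.mem_univ, true_and] at hT'
    obtain ⟨i, rfl⟩ := hT'
    simp only [Finset.mem_union, Finset.mem_singleton, Finset.mem_image, Finset.mem_univ,
      true_and] at hT
    have h2 := Finset.card_pair (hne i)
    rcases hT with h | ⟨j, h⟩
    · simp [h] at h2
    · simp [← h] at h2

theorem sum_powerset_superset {V : Type*} [DecidableEq V] {A W : Finset V} (h : A ⊆ W) :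
    ∑ Y ∈ W.powerset with A ⊆ Y, (-1 : ℤ) ^ Y.card = if A = W then (-1) ^ W.card else 0 := by
  have hI : W.powerset.filter (A ⊆ ·) = (W \ A).powerset.image (A ∪ ·) := by
    rw [← Finset.Icc_eq_image_powerset h]
    ext Y
    simp [and_comm]
  have hd : ∀ Z ∈ (W \ A).powerset, Disjoint A Z := fun Z hZ =>
    Finset.disjoint_of_subset_right (Finset.mem_powerset.1 hZ) Finset.disjoint_sdiff
  rw [hI, Finset.sum_image]
  · rw [Finset.sum_congr rfl fun Z hZ => by rw [Finset.card_union_of_disjoint (hd Z hZ), pow_add],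
      ← Finset.mul_sum, Finset.sum_powerset_neg_one_pow_card]
    simp only [Finset.sdiff_eq_empty_iff_subset]
    by_cases hAW : A = W
    · simp [hAW]
    · rw [if_neg hAW, if_neg fun h' => hAW (h.antisymm h'), mul_zero]
  · intro Z hZ Z' hZ' hE
    have e : ∀ X ∈ (W \ A).powerset, (A ∪ X) \ A = X := fun X hX => by
      rw [Finset.union_sdiff_left, Finset.sdiff_eq_self_of_disjoint (hd X hX).symm]
    rw [← e Z hZ, ← e Z' hZ']
    exact congrArg (· \ A) hE

/-! ### Induced cycles of the complement contradict the Möbius sign -/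

section Obstruction

variable {V P : Type*} [PartialOrder P] [OrderBot P] {G : SimpleGraph V}
  {S : P ↪o Finset V}

theorem embedding_bot (hS : ∀ W, W ∈ Set.range S ↔ NoIsolated G W) : S ⊥ = ∅ := by
  obtain ⟨p, hp⟩ := (hS ∅).2 (by simp [NoIsolated])
  exact Finset.subset_empty.1 (hp ▸ S.monotone bot_le)

variable [Fintype P] {μ : P → ℤ}

open Classical in
-- The members of the lattice contained in `Y` have a largest one, consisting of the vertices of `Y`
-- with a neighbour in `Y`. It is `⊥` exactly when `Y` is independent.
theorem sum_moebius_subset (hS : ∀ W, W ∈ Set.range S ↔ NoIsolated G W)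
    (hμ : ∀ y, ∑ z with z ≤ y, μ z = if y = ⊥ then 1 else 0) (Y : Finset V) :
    ∑ z with S z ⊆ Y, μ z = if ∀ a ∈ Y, ∀ b ∈ Y, ¬ G.Adj a b then 1 else 0 := by
  obtain ⟨c, hc⟩ := (hS (Y.filter fun v => ∃ w ∈ Y, G.Adj v w)).2 (by
    intro v hv
    obtain ⟨hv, w, hw, hvw⟩ := Finset.mem_filter.1 hv
    exact ⟨w, Finset.mem_filter.2 ⟨hw, v, hv, hvw.symm⟩, hvw⟩)
  have h1 : ∀ z, S z ⊆ Y ↔ z ≤ c := by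
    intro z
    rw [← S.le_iff_le, hc]
    constructor
    · intro h v hv
      obtain ⟨w, hw, hvw⟩ := (hS (S z)).1 ⟨z, rfl⟩ v hv
      exact Finset.mem_filter.2 ⟨h hv, w, h hw, hvw⟩
    · exact fun h => h.trans (Finset.filter_subset _ _)
  have h2 : c = ⊥ ↔ ∀ a ∈ Y, ∀ b ∈ Y, ¬ G.Adj a b := by
    rw [← S.injective.eq_iff, embedding_bot hS, hc, Finset.filter_eq_empty_iff]
    push Not
    rfl
  simp only [h1, hμ, h2]

open Classical in
theorem sum_independent_eq (hS : ∀ W, W ∈ Set.range S ↔ NoIsolated G W)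
    (hμ : ∀ y, ∑ z with z ≤ y, μ z = if y = ⊥ then 1 else 0) (w : P) :
    ∑ Y ∈ (S w).powerset, (-1 : ℤ) ^ Y.card *
      (if ∀ a ∈ Y, ∀ b ∈ Y, ¬ G.Adj a b then 1 else 0) = (-1) ^ (S w).card * μ w := by
  calc _ = ∑ Y ∈ (S w).powerset, ∑ z, if S z ⊆ Y then (-1 : ℤ) ^ Y.card * μ z else 0 := by
        refine Finset.sum_congr rfl fun Y _ => ?_
        rw [← sum_moebius_subset hS hμ, Finset.mul_sum, Finset.sum_filter]
    _ = ∑ z, (∑ Y ∈ (S w).powerset with S z ⊆ Y, (-1 : ℤ) ^ Y.card) * μ z := by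
        rw [Finset.sum_comm]
        refine Finset.sum_congr rfl fun z _ => ?_
        rw [Finset.sum_mul, Finset.sum_filter]
    _ = ∑ z, if z = w then (-1) ^ (S w).card * μ w else 0 := by
        refine Finset.sum_congr rfl fun z _ => ?_
        by_cases hz : S z ⊆ S w
        · rw [sum_powerset_superset hz]
          simp only [S.injective.eq_iff]
          split_ifs with h
          · rw [h]
          · rw [zero_mul]
        · rw [Finset.filter_false_of_mem, Finset.sum_empty, zero_mul, if_neg]
          · rintro rfl
            exact hz subset_rfl
          · exact fun Y hY h => hz (h.trans (Finset.mem_powerset.1 hY))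
    _ = _ := by simp

theorem noIsolated_map_cycleGraph {n : ℕ} (hn : 4 ≤ n)
    (f : SimpleGraph.cycleGraph n ↪g Gᶜ) : NoIsolated G (Finset.univ.map f.toEmbedding) := by
  intro v hv
  obtain ⟨i, -, rfl⟩ := Finset.mem_map.1 hv
  have hi := i.isLt
  obtain ⟨j, hij, hadj⟩ : ∃ j, i ≠ j ∧ ¬ (SimpleGraph.cycleGraph n).Adj i j := by
    have h1 := cycleNext_val i
    have h2 := cycleNext_val (cycleNext i)
    -- As `n ≥ 4`, the vertex two steps ahead is distinct from `i` and not adjacent to it in the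
    -- cycle, hence adjacent in `G`.
    refine ⟨cycleNext (cycleNext i), ?_, ?_⟩
    · rw [Ne, Fin.ext_iff]
      omega
    · rw [cycleGraph_adj_iff_val (by omega)]
      omega
  refine ⟨f j, Finset.mem_map.2 ⟨j, Finset.mem_univ _, rfl⟩, ?_⟩
  have h1 : ¬ Gᶜ.Adj (f i) (f j) := fun h => hadj (f.map_adj_iff.1 h)
  rw [SimpleGraph.compl_adj] at h1
  by_contra h
  exact h1 ⟨fun e => hij (f.injective e), h⟩

open Classical in
theorem sum_independent_map_cycleGraph {n : ℕ} (hn : 4 ≤ n)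
    (f : SimpleGraph.cycleGraph n ↪g Gᶜ) :
    ∑ Y ∈ (Finset.univ.map f.toEmbedding).powerset, (-1 : ℤ) ^ Y.card *
      (if ∀ a ∈ Y, ∀ b ∈ Y, ¬ G.Adj a b then 1 else 0) = 1 := by
  refine Eq.trans ?_ (sum_cliques_cycleGraph hn)
  have : (Finset.univ.map f.toEmbedding).powerset =
      (Finset.univ : Finset (Finset (Fin n))).map (Finset.mapEmbedding f.toEmbedding).toEmbedding := by
    ext Y
    simp only [Finset.mem_powerset, Finset.mem_map, Finset.mem_univ, true_and]
    rw [Finset.subset_map_iff]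
    simp [eq_comm]
  rw [this, Finset.sum_map]
  refine Finset.sum_congr rfl fun T _ => ?_
  simp only [RelEmbedding.coe_toEmbedding, Finset.mapEmbedding_apply, Finset.card_map]
  congr 1
  refine if_congr ?_ rfl rfl
  constructor
  · intro h a ha b hb hab
    rw [← f.map_adj_iff, SimpleGraph.compl_adj]
    exact ⟨fun e => hab (f.injective e),
      h _ (Finset.mem_map_of_mem _ ha) _ (Finset.mem_map_of_mem _ hb)⟩
  · intro h a ha b hb hab
    obtain ⟨i, hi, rfl⟩ := Finset.mem_map.1 ha
    obtain ⟨j, hj, rfl⟩ := Finset.mem_map.1 hb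
    have hij : i ≠ j := by
      rintro rfl
      exact hab.ne rfl
    have := f.map_adj_iff.2 (h hi hj hij)
    rw [SimpleGraph.compl_adj] at this
    exact this.2 hab

/-- If the lcm-lattice of `G` is `2`-degree graded and has a CL-labeling, then the complement of
`G` has no induced cycle of length at least four. -/
theorem isCochordal_of_isCLLabeling (hS : ∀ W, W ∈ Set.range S ↔ NoIsolated G W)
    (hcov : ∀ a b : P, a ≠ ⊥ → a ⋖ b → (S b).card = (S a).card + 1)
    (hatom : ∀ a : P, IsAtom a → (S a).card = 2)
    {Λ : Type*} [PartialOrder Λ] {lab : List P → Λ} (hlab : IsCLLabeling lab) :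
    IsCochordal G := by
  classical
  rintro n hn ⟨f⟩
  have hpos : ∀ a : P, a ≠ ⊥ → 1 ≤ (S a).card := by
    intro a ha
    rw [Nat.one_le_iff_ne_zero, Ne, Finset.card_eq_zero, ← embedding_bot hS, S.injective.eq_iff]
    exact ha
  -- Truncated subtraction gives `⊥` rank `0`, and atoms, of size `2`, get rank `1`.
  obtain ⟨μ, hμ, hsign⟩ := hlab.exists_moebius (ρ := fun a => (S a).card - 1) (by
    intro a b hab
    by_cases ha : a = ⊥
    · subst ha
      have := hatom b (bot_covBy_iff.1 hab)
      simp [embedding_bot hS, this]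
    · have := hcov a b ha hab
      have := hpos a ha
      omega) (by simp [embedding_bot hS])
  obtain ⟨w, hw⟩ := (hS _).2 (noIsolated_map_cycleGraph hn f)
  have h1 := sum_independent_eq hS hμ w
  rw [hw, sum_independent_map_cycleGraph hn f, ← hw] at h1
  have h2 := hsign w
  have hcard : (S w).card = ((S w).card - 1) + 1 := by
    have : (S w).card = n := by rw [hw]; simp
    omega
  rw [hcard, pow_succ] at h1
  linarith

end Obstruction

/-! ### Dirac's theorem and elimination orderings -/

section Dirac

variable {V : Type*} {H : SimpleGraph V}

/-- The graph on the same vertices whose edges are the edges of `H` inside `Z`. -/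
def edgesWithin (H : SimpleGraph V) (Z : Set V) : SimpleGraph V where
  Adj a b := H.Adj a b ∧ a ∈ Z ∧ b ∈ Z
  symm := ⟨fun _ _ h => ⟨h.1.symm, h.2.2, h.2.1⟩⟩
  loopless := ⟨fun _ h => h.1.ne rfl⟩

theorem dist_getVert_of_length_eq_dist {s t : V} (p : H.Walk s t) (hp : p.length = H.dist s t)
    {i : ℕ} (hi : i ≤ p.length) : H.dist s (p.getVert i) = i := by
  have h1 := H.dist_le (p.take i)
  have h2 := H.dist_le (p.drop i)
  have h3 := (p.take i).reachable.dist_triangle_left t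
  rw [SimpleGraph.Walk.take_length] at h1
  rw [SimpleGraph.Walk.drop_length] at h2
  omega

/-- Otherwise a shortest path from `s` to `t` with interior in `C` has length `d ≥ 2`, is induced,
and closes up through `u` to an induced cycle of length `d + 2`. -/
theorem IsChordal.adj_of_reachable (hH : IsChordal H) {u s t : V} {C : Set V} (hst : s ≠ t)
    (hs : H.Adj u s) (ht : H.Adj u t) (hC : ∀ c ∈ C, c ≠ u ∧ ¬ H.Adj u c)
    (hr : (edgesWithin H (C ∪ {s, t})).Reachable s t) : H.Adj s t := by
  by_contra hadj
  set K := edgesWithin H (C ∪ {s, t}) with hK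
  obtain ⟨p, hp⟩ := hr.exists_walk_length_eq_dist
  have hdist := fun i hi => dist_getVert_of_length_eq_dist p hp (i := i) hi
  set d := p.length with hd
  have hd2 : 1 < d := by
    rw [hp]
    exact hr.one_lt_dist_of_ne_of_not_adj hst fun h => hadj h.1
  have h0 : p.getVert 0 = s := p.getVert_zero
  have hl : p.getVert d = t := p.getVert_length
  have hmem : ∀ i ≤ d, p.getVert i ∈ C ∪ {s, t} := by
    intro i hi
    rcases hi.eq_or_lt with rfl | hlt
    · rw [hl]
      simp
    · exact (p.adj_getVert_succ hlt).2.1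
  have hpath : ∀ i ≤ d, ∀ j ≤ d, H.Adj (p.getVert i) (p.getVert j) ↔ i + 1 = j ∨ j + 1 = i := by
    intro i hi j hj
    constructor
    · intro h
      have hKadj : K.Adj (p.getVert i) (p.getVert j) := ⟨h, hmem i hi, hmem j hj⟩
      have h1 := hKadj.diff_dist_adj (u := s)
      have hne : i ≠ j := by
        rintro rfl
        exact h.ne rfl
      rw [hdist i hi, hdist j hj] at h1
      omega
    · rintro (rfl | rfl)
      · exact (p.adj_getVert_succ hj).1
      · exact (p.adj_getVert_succ hi).1.symm
  have hu : ∀ i ≤ d, p.getVert i ≠ u ∧ (H.Adj u (p.getVert i) ↔ i = 0 ∨ i = d) := by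
    intro i hi
    by_cases h1 : i = 0
    · subst h1
      rw [h0]
      exact ⟨hs.ne', by simp [hs]⟩
    by_cases h2 : i = d
    · rw [h2, hl]
      exact ⟨ht.ne', by simp [ht]⟩
    have hc : p.getVert i ∈ C := by
      rcases hmem i hi with h | h | h
      · exact h
      · have := hdist i hi
        rw [h, SimpleGraph.dist_self] at this
        omega
      · have := hdist i hi
        rw [h] at this
        omega
    exact ⟨(hC _ hc).1, by simp [h1, h2, (hC _ hc).2]⟩
  -- The cycle runs through the path at positions `0, ..., d` and returns through `u` at position `d
  -- + 1`.
  let f : Fin (d + 2) → V := fun i => if i.val ≤ d then p.getVert i.val else u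
  have hf1 : ∀ i : Fin (d + 2), i.val ≤ d → f i = p.getVert i.val := fun i hi => if_pos hi
  have hf2 : ∀ i : Fin (d + 2), ¬ i.val ≤ d → f i = u := fun i hi => if_neg hi
  refine hH (d + 2) (by omega) ⟨⟨⟨f, fun i j hij => ?_⟩, fun {i j} => ?_⟩⟩
  · have hi := i.isLt
    have hj := j.isLt
    rw [Fin.ext_iff]
    by_cases h1 : i.val ≤ d <;> by_cases h2 : j.val ≤ d
    · rw [hf1 i h1, hf1 j h2] at hij
      rw [← hdist _ h1, ← hdist _ h2, hij]
    · rw [hf1 i h1, hf2 j h2] at hij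
      exact absurd hij (hu _ h1).1
    · rw [hf2 i h1, hf1 j h2] at hij
      exact absurd hij.symm (hu _ h2).1
    · omega
  · change H.Adj (f i) (f j) ↔ _
    have hi := i.isLt
    have hj := j.isLt
    rw [cycleGraph_adj_iff_val (by omega)]
    by_cases h1 : i.val ≤ d <;> by_cases h2 : j.val ≤ d
    · rw [hf1 i h1, hf1 j h2, hpath _ h1 _ h2]
      omega
    · rw [hf1 i h1, hf2 j h2, H.adj_comm, (hu _ h1).2]
      omega
    · rw [hf2 i h1, hf1 j h2, (hu _ h2).2]
      omega
    · rw [hf2 i h1, hf2 j h2]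
      simp only [SimpleGraph.irrefl, false_iff]
      omega

/-- The neighbours of `v` within `X` form a clique. -/
def IsSimplicialIn (H : SimpleGraph V) (X : Finset V) (v : V) : Prop :=
  ∀ a ∈ X, ∀ b ∈ X, H.Adj v a → H.Adj v b → a ≠ b → H.Adj a b

/-- Dirac's theorem: in a chordal graph, every vertex that is not universal has a simplicial
non-neighbour. -/
theorem IsChordal.exists_isSimplicialIn_of_not_adj (hH : IsChordal H) (X : Finset V) :
    ∀ u ∈ X, (∃ w ∈ X, w ≠ u ∧ ¬ H.Adj u w) →
      ∃ v ∈ X, v ≠ u ∧ ¬ H.Adj u v ∧ IsSimplicialIn H X v := by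
  classical
  induction X using Finset.strongInduction with
  | H X ih =>
  rintro u hu ⟨w, hw, hwu, huw⟩
  -- `C` is the component of `w` among the non-neighbours of `u`, and `S` is its set of neighbours
  -- adjacent to `u`. `S` is a clique that separates `C` from the rest of `X`, so a vertex of `C`
  -- simplicial in `C ∪ S` is simplicial in `X`.
  set Y : Set V := {a | a ∈ X ∧ a ≠ u ∧ ¬ H.Adj u a} with hY
  set C : Set V := {c | c ∈ Y ∧ (edgesWithin H Y).Reachable w c} with hC
  set S : Set V := {s | s ∈ X ∧ H.Adj u s ∧ ∃ c ∈ C, H.Adj s c} with hS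
  have hwC : w ∈ C := ⟨⟨hw, hwu, huw⟩, SimpleGraph.Reachable.refl _⟩
  have hreach : ∀ Z : Set V, C ⊆ Z → ∀ c ∈ C, (edgesWithin H Z).Reachable w c := by
    intro Z hZ c hc
    have h := (SimpleGraph.reachable_iff_reflTransGen _ _).1 hc.2
    rw [SimpleGraph.reachable_iff_reflTransGen]
    induction h with
    | refl => exact Relation.ReflTransGen.refl
    | tail hab hbc ih' =>
      have hb : _ ∈ C := ⟨hbc.2.1, (SimpleGraph.reachable_iff_reflTransGen _ _).2 hab⟩
      exact (ih' hb).tail ⟨hbc.1, hZ hb, hZ hc⟩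
  have hclique : ∀ s ∈ S, ∀ t ∈ S, s ≠ t → H.Adj s t := by
    rintro s ⟨hsX, hus, c, hc, hsc⟩ t ⟨htX, hut, c', hc', htc'⟩ hst
    refine hH.adj_of_reachable hst hus hut (C := C) (fun c hc => hc.1.2) ?_
    have hZ : C ⊆ C ∪ {s, t} := Set.subset_union_left
    have e1 : (edgesWithin H (C ∪ {s, t})).Adj s c := ⟨hsc, by simp, hZ hc⟩
    have e2 : (edgesWithin H (C ∪ {s, t})).Adj t c' := ⟨htc', by simp, hZ hc'⟩
    exact (e1.reachable.trans (hreach _ hZ c hc).symm).trans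
      ((hreach _ hZ c' hc').trans e2.reachable.symm)
  set X' : Finset V := X.filter fun a => a ∈ C ∨ a ∈ S with hX'
  have hmem : ∀ a, a ∈ X' ↔ a ∈ C ∨ a ∈ S := by
    intro a
    rw [hX', Finset.mem_filter, and_iff_right_iff_imp]
    rintro (h | h)
    · exact h.1.1
    · exact h.1
  have hss : X' ⊂ X := by
    refine (Finset.ssubset_iff_of_subset (Finset.filter_subset _ _)).2 ⟨u, hu, fun h => ?_⟩
    rcases (hmem u).1 h with h | h
    · exact h.1.2.1 rfl
    · exact h.2.1.ne rfl
  have hclosed : ∀ c ∈ C, ∀ a ∈ X, H.Adj c a → a ∈ X' := by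
    intro c hc a ha hca
    rw [hmem]
    by_cases hua : H.Adj u a
    · exact Or.inr ⟨ha, hua, c, hc, hca.symm⟩
    · have hau : a ≠ u := by
        rintro rfl
        exact hc.1.2.2 hca.symm
      have haY : a ∈ Y := ⟨ha, hau, hua⟩
      have e : (edgesWithin H Y).Adj c a := ⟨hca, hc.1, haY⟩
      exact Or.inl ⟨haY, hc.2.trans e.reachable⟩
  have hfinish : ∀ v ∈ C, IsSimplicialIn H X' v →
      ∃ v ∈ X, v ≠ u ∧ ¬ H.Adj u v ∧ IsSimplicialIn H X v := by
    intro v hv hsimp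
    exact ⟨v, hv.1.1, hv.1.2.1, hv.1.2.2, fun a ha b hb hva hvb =>
      hsimp a (hclosed v hv a ha hva) b (hclosed v hv b hb hvb) hva hvb⟩
  -- The induction hypothesis must return a vertex of `C`. A non-neighbour of some `s ∈ S` avoids
  -- the clique `S`; if `S` is universal in `X'`, so does a non-neighbour of some `c ∈ C`; if
  -- neither exists, `X'` is a clique.
  by_cases h1 : ∃ s ∈ S, ∃ z ∈ X', z ≠ s ∧ ¬ H.Adj s z
  · obtain ⟨s, hs, hz⟩ := h1
    obtain ⟨v, hv, hvs, hsv, hsimp⟩ := ih X' hss s ((hmem s).2 (Or.inr hs)) hz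
    refine hfinish v (((hmem v).1 hv).resolve_right fun hvS => ?_) hsimp
    exact hsv (hclique s hs v hvS hvs.symm)
  · push Not at h1
    by_cases h2 : ∃ c ∈ C, ∃ z ∈ X', z ≠ c ∧ ¬ H.Adj c z
    · obtain ⟨c, hc, hz⟩ := h2
      obtain ⟨v, hv, hvc, hcv, hsimp⟩ := ih X' hss c ((hmem c).2 (Or.inl hc)) hz
      refine hfinish v (((hmem v).1 hv).resolve_right fun hvS => ?_) hsimp
      exact hcv (h1 v hvS c ((hmem c).2 (Or.inl hc)) hvc.symm).symm
    · push Not at h2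
      refine hfinish w hwC fun a ha b hb _ _ hab => ?_
      rcases (hmem a).1 ha with h | h
      · exact h2 a h b hb hab.symm
      · exact h1 a h b hb hab.symm

theorem IsChordal.exists_isSimplicialIn (hH : IsChordal H) {X : Finset V} (hX : X.Nonempty) :
    ∃ v ∈ X, IsSimplicialIn H X v := by
  by_cases h : ∃ u ∈ X, ∃ w ∈ X, w ≠ u ∧ ¬ H.Adj u w
  · obtain ⟨u, hu, hw⟩ := h
    obtain ⟨v, hv, -, -, hs⟩ := hH.exists_isSimplicialIn_of_not_adj X u hu hw
    exact ⟨v, hv, hs⟩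
  · push Not at h
    obtain ⟨v, hv⟩ := hX
    exact ⟨v, hv, fun a ha b hb _ _ hab => h a ha b hb hab.symm⟩

/-- A chordal graph has a perfect elimination ordering (by decreasing `ord`). -/
theorem IsChordal.exists_elimination_ordering_on (hH : IsChordal H) (X : Finset V) :
    ∃ ord : V → ℕ, Set.InjOn ord X ∧ ∀ c ∈ X, ∀ a ∈ X, ∀ b ∈ X, ord a < ord c → ord b < ord c →
      a ≠ b → H.Adj c a → H.Adj c b → H.Adj a b := by
  classical
  induction X using Finset.strongInduction with
  | H X ih =>
  rcases X.eq_empty_or_nonempty with rfl | hX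
  · exact ⟨fun _ => 0, by simp, by simp⟩
  obtain ⟨v, hv, hsimp⟩ := hH.exists_isSimplicialIn hX
  obtain ⟨ord, hinj, hord⟩ := ih (X.erase v) (Finset.erase_ssubset hv)
  have hlt : ∀ a ∈ X, ord a < X.sup ord + 1 := fun a ha => Nat.lt_succ_of_le (Finset.le_sup ha)
  -- The simplicial vertex is placed after all others.
  refine ⟨fun a => if a = v then X.sup ord + 1 else ord a, ?_, ?_⟩
  · intro a ha b hb hab
    have := hlt a ha
    have := hlt b hb
    dsimp only at hab
    split_ifs at hab with h1 h2 h2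
    · rw [h1, h2]
    · omega
    · omega
    · exact hinj (by simpa [h1] using ha) (by simpa [h2] using hb) hab
  · intro c hc a ha b hb hac hbc hab hca hcb
    by_cases h : c = v
    · subst h
      exact hsimp a ha b hb hca hcb hab
    · have := hlt c hc
      simp only [if_neg h] at hac hbc
      split_ifs at hac hbc with h1 h2 h2
      · omega
      · omega
      · omega
      · exact hord c (by simp [h, hc]) a (by simp [h1, ha]) b (by simp [h2, hb]) hac hbc hab hca hcb

/-- In a co-chordal graph, the vertices can be ordered so that every edge below a vertex `c` has an
endpoint adjacent to `c`. -/
theorem IsCochordal.exists_ordering [Finite V] {G : SimpleGraph V} (hG : IsCochordal G) :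
    ∃ ord : V → ℕ, Function.Injective ord ∧ ∀ a b c, ord a < ord c → ord b < ord c →
      G.Adj a b → G.Adj c a ∨ G.Adj c b := by
  have := Fintype.ofFinite V
  obtain ⟨ord, hinj, hord⟩ := IsChordal.exists_elimination_ordering_on hG Finset.univ
  refine ⟨ord, fun a b h => hinj (by simp) (by simp) h, fun a b c hac hbc hab => ?_⟩
  by_contra hcon
  push Not at hcon
  have h := hord c (by simp) a (by simp) b (by simp) hac hbc hab.ne
    ((G.compl_adj _ _).2 ⟨fun e => hac.ne (by rw [e]), hcon.1⟩)
    ((G.compl_adj _ _).2 ⟨fun e => hbc.ne (by rw [e]), hcon.2⟩)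
  exact ((G.compl_adj _ _).1 h).2 hab

end Dirac

/-! ### Purity from a rank function -/

/-- Every maximal chain contains exactly one element of each rank from `0` to `ρ ⊤`. -/
theorem isGraded_of_rank {P : Type*} [PartialOrder P] [BoundedOrder P] [Finite P] {ρ : P → ℕ}
    (hρ : ∀ a b : P, a ⋖ b → ρ b = ρ a + 1) (hbot : ρ ⊥ = 0) : IsGraded P := by
  have hmono : StrictMono ρ := by
    intro a b hab
    induction a using WellFoundedGT.induction with
    | _ a ih =>
      obtain ⟨c, hac, hcb⟩ := exists_covBy_le_of_lt hab
      have h1 := hρ a c hac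
      rcases hcb.eq_or_lt with rfl | h
      · omega
      · have := ih c hac.lt h
        omega
  have hcard : ∀ s : Flag P, (s : Set P).ncard = ρ ⊤ + 1 := by
    intro s
    have hinj : Set.InjOn ρ (s : Set P) := by
      intro a ha b hb hab
      rcases s.le_or_le ha hb with h | h
      · exact h.eq_of_not_lt fun h' => (hmono h').ne hab
      · exact (h.eq_of_not_lt fun h' => (hmono h').ne hab.symm).symm
    have himage : ρ '' (s : Set P) = Set.Iic (ρ ⊤) := by
      refine Set.Subset.antisymm ?_ fun n hn => ?_
      · rintro _ ⟨a, -, rfl⟩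
        exact hmono.monotone le_top
      · induction n with
        | zero => exact ⟨⊥, s.bot_mem, hbot⟩
        | succ n ih =>
          obtain ⟨a, ha, han⟩ := ih (Set.mem_Iic.2 ((Nat.le_succ n).trans hn))
          rw [Set.mem_Iic] at hn
          have hne : {b : P | b ∈ s ∧ a < b}.Nonempty := by
            refine ⟨⊤, s.top_mem, lt_top_iff_ne_top.2 ?_⟩
            rintro rfl
            omega
          obtain ⟨b, ⟨hb, hab⟩, hmin⟩ := Set.Finite.exists_minimal (Set.toFinite _) hne
          refine ⟨b, hb, ?_⟩
          rw [hρ a b ⟨hab, fun c hac hcb => ?_⟩, han]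
          -- An element strictly between two consecutive elements of the chain is comparable to the
          -- whole chain, so maximality puts it in the chain.
          have hc : c ∈ s := by
            rw [Flag.mem_iff_forall_le_or_ge]
            intro t ht
            rcases s.le_or_le ht ha with h | h
            · exact Or.inr (h.trans hac.le)
            · rcases h.eq_or_lt with rfl | h
              · exact Or.inr hac.le
              · refine Or.inl (hcb.le.trans ?_)
                rcases s.le_or_le hb ht with h' | h'
                · exact h'
                · exact hmin ⟨ht, h⟩ h'
          exact absurd (hmin ⟨hc, hac⟩ hcb.le) hcb.not_ge
    rw [← hinj.ncard_image, himage, Set.ncard_eq_toFinset_card']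
    simp
  exact ⟨inferInstance, fun s t => by rw [hcard, hcard]⟩

/-! ### Linear quotients of the edges -/

section Ordering

variable {V : Type*} {G : SimpleGraph V} {ord : V → ℕ}

/-- Every edge below a vertex `c` has an endpoint adjacent to `c`. -/
def IsEliminationOrdering (G : SimpleGraph V) (ord : V → ℕ) : Prop :=
  Function.Injective ord ∧ ∀ a b c, ord a < ord c → ord b < ord c →
    G.Adj a b → G.Adj c a ∨ G.Adj c b

/-- Two disjoint edges are always joined by a third: the largest of the four vertices is adjacent to
an endpoint of the edge not containing it. -/
theorem IsEliminationOrdering.exists_adj (h : IsEliminationOrdering G ord) {a b v w : V}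
    (hab : G.Adj a b) (hvw : G.Adj v w) (hva : v ≠ a) (hvb : v ≠ b) (hwa : w ≠ a) (hwb : w ≠ b) :
    (G.Adj v a ∨ G.Adj v b) ∨ (G.Adj w a ∨ G.Adj w b) := by
  have h1 := h.1.ne hva
  have h2 := h.1.ne hvb
  have h3 := h.1.ne hwa
  have h4 := h.1.ne hwb
  have h5 := h.1.ne hab.ne
  have h6 := h.1.ne hvw.ne
  have k1 := h.2 a b v
  have k2 := h.2 a b w
  have k3 := h.2 v w a
  have k4 := h.2 v w b
  by_cases c1 : ord a < ord v ∧ ord b < ord v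
  · exact Or.inl (k1 c1.1 c1.2 hab)
  by_cases c2 : ord a < ord w ∧ ord b < ord w
  · exact Or.inr (k2 c2.1 c2.2 hab)
  by_cases c3 : ord v < ord a ∧ ord w < ord a
  · rcases k3 c3.1 c3.2 hvw with k | k
    · exact Or.inl (Or.inl k.symm)
    · exact Or.inr (Or.inl k.symm)
  by_cases c4 : ord v < ord b ∧ ord w < ord b
  · rcases k4 c4.1 c4.2 hvw with k | k
    · exact Or.inl (Or.inr k.symm)
    · exact Or.inr (Or.inr k.symm)
  clear k1 k2 k3 k4
  omega

/-- The vertex sets of the edges of a graph. -/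
def IsEdge (G : SimpleGraph V) (e : Finset V) : Prop :=
  ∃ a b, G.Adj a b ∧ (e : Set V) = {a, b}

theorem IsEdge.noIsolated {e : Finset V} (he : IsEdge G e) : NoIsolated G e := by
  obtain ⟨a, b, hab, h⟩ := he
  have hmem : ∀ v, v ∈ e ↔ v = a ∨ v = b := fun v => by rw [← Finset.mem_coe, h]; rfl
  intro v hv
  rcases (hmem v).1 hv with rfl | rfl
  · exact ⟨b, (hmem b).2 (Or.inr rfl), hab⟩
  · exact ⟨a, (hmem a).2 (Or.inl rfl), hab.symm⟩

/-- A weight by which edges are compared, first by their largest vertex. -/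
def weight (ord : V → ℕ) (e : Finset V) : ℕ := ∑ v ∈ e, 2 ^ ord v

theorem weight_pair [DecidableEq V] {a b : V} (h : a ≠ b) :
    weight ord {a, b} = 2 ^ ord a + 2 ^ ord b :=
  Finset.sum_pair h

theorem isEdge_pair [DecidableEq V] {a b : V} (h : G.Adj a b) : IsEdge G {a, b} :=
  ⟨a, b, h, by simp⟩

theorem IsEdge.exists_eq [DecidableEq V] {e : Finset V} (he : IsEdge G e) :
    ∃ a b, G.Adj a b ∧ e = {a, b} := by
  obtain ⟨a, b, hab, h⟩ := he
  exact ⟨a, b, hab, Finset.coe_injective (by simpa using h)⟩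

theorem two_pow_add_two_pow_lt {c d m : ℕ} (hc : c < m) (hd : d < m) (h : c ≠ d) :
    2 ^ c + 2 ^ d < 2 ^ m := by
  wlog hcd : c < d generalizing c d
  · rw [add_comm]
    exact this hd hc h.symm (by omega)
  have h1 : 2 ^ c < 2 ^ d := Nat.pow_lt_pow_right (by norm_num) hcd
  have h2 : 2 ^ (d + 1) ≤ 2 ^ m := Nat.pow_le_pow_right (by norm_num) hd
  rw [pow_succ] at h2
  omega

theorem weight_injective (h : Function.Injective ord) : Function.Injective (weight ord) := by
  intro e f hw
  refine Finset.map_injective ⟨ord, h⟩ (Finset.geomSum_injective le_rfl ?_)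
  simpa [Finset.sum_map, weight] using hw

/-- Adding the vertex `v` to the edge `e` creates an edge of larger weight. -/
def IsEarly (G : SimpleGraph V) (ord : V → ℕ) (e : Finset V) (v : V) : Prop :=
  v ∉ e ∧ ∃ l, IsEdge G l ∧ (∀ u ∈ l, u = v ∨ u ∈ e) ∧ weight ord e < weight ord l

theorem IsEarly.exists_adj {e : Finset V} {v : V} (h : IsEarly G ord e v) :
    ∃ u ∈ e, G.Adj u v := by
  obtain ⟨-, l, hl, hsub, hw⟩ := h
  obtain ⟨a, b, hab, hl⟩ := hl
  have ha := hsub a (by rw [← Finset.mem_coe, hl]; simp)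
  have hb := hsub b (by rw [← Finset.mem_coe, hl]; simp)
  rcases ha with rfl | ha
  · rcases hb with rfl | hb
    · exact absurd rfl hab.ne
    · exact ⟨b, hb, hab.symm⟩
  · rcases hb with rfl | hb
    · exact ⟨a, ha, hab⟩
    -- An edge inside `e` cannot outweigh `e`, so `l` must contain `v`.
    · refine absurd (Finset.sum_le_sum_of_subset (f := fun v => 2 ^ ord v) fun u hu => ?_) hw.not_ge
      rw [← Finset.mem_coe, hl] at hu
      rcases hu with rfl | rfl
      · exact ha
      · exact hb

/-- The edges, ordered by decreasing weight, have linear quotients. -/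
theorem IsEliminationOrdering.exists_isEarly (h : IsEliminationOrdering G ord) {e f : Finset V}
    (he : IsEdge G e) (hf : IsEdge G f) (hw : weight ord f < weight ord e) :
    ∃ v ∈ e, IsEarly G ord f v := by
  classical
  by_cases hshare : ∃ c ∈ e, c ∈ f
  · obtain ⟨c, hce, hcf⟩ := hshare
    obtain ⟨d, hd⟩ : ∃ d, e = {c, d} := by
      obtain ⟨p, q, -, rfl⟩ := he.exists_eq
      simp only [Finset.mem_insert, Finset.mem_singleton] at hce
      rcases hce with rfl | rfl
      · exact ⟨q, rfl⟩
      · exact ⟨p, Finset.pair_comm _ _⟩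
    refine ⟨d, by simp [hd], fun hdf => ?_, e, he, fun u hu => ?_, hw⟩
    · refine hw.not_ge (Finset.sum_le_sum_of_subset ?_)
      rw [hd, Finset.insert_subset_iff, Finset.singleton_subset_iff]
      exact ⟨hcf, hdf⟩
    · rw [hd, Finset.mem_insert, Finset.mem_singleton] at hu
      rcases hu with rfl | rfl
      · exact Or.inr hcf
      · exact Or.inl rfl
  · push Not at hshare
    obtain ⟨a, b, hab, rfl⟩ := hf.exists_eq
    -- Replacing one endpoint of `{a, b}` by the larger vertex `c` increases the weight. Since `e`
    -- is disjoint from `f` and heavier, its largest vertex exceeds both `a` and `b`.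
    have main : ∀ c ∈ e, ord a < ord c → ord b < ord c → IsEarly G ord {a, b} c := by
      intro c hc hac hbc
      refine ⟨hshare c hc, ?_⟩
      have p1 : 2 ^ ord a < 2 ^ ord c := Nat.pow_lt_pow_right (by norm_num) hac
      have p2 : 2 ^ ord b < 2 ^ ord c := Nat.pow_lt_pow_right (by norm_num) hbc
      rcases h.2 a b c hac hbc hab with h' | h'
      · refine ⟨{c, a}, isEdge_pair h', fun u hu => ?_, ?_⟩
        · simp only [Finset.mem_insert, Finset.mem_singleton] at hu ⊢
          tauto
        · rw [weight_pair hab.ne, weight_pair h'.ne]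
          omega
      · refine ⟨{c, b}, isEdge_pair h', fun u hu => ?_, ?_⟩
        · simp only [Finset.mem_insert, Finset.mem_singleton] at hu ⊢
          tauto
        · rw [weight_pair hab.ne, weight_pair h'.ne]
          omega
    obtain ⟨c, d, hcd, rfl⟩ := he.exists_eq
    have hc : c ∈ ({c, d} : Finset V) := by simp
    have hd : d ∈ ({c, d} : Finset V) := by simp
    have h1 := h.1.ne hcd.ne
    have hca : ord c ≠ ord a := h.1.ne fun e => hshare c hc (by simp [e])
    have hcb : ord c ≠ ord b := h.1.ne fun e => hshare c hc (by simp [e])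
    have hda : ord d ≠ ord a := h.1.ne fun e => hshare d hd (by simp [e])
    have hdb : ord d ≠ ord b := h.1.ne fun e => hshare d hd (by simp [e])
    rw [weight_pair hab.ne, weight_pair hcd.ne] at hw
    have k1 := @two_pow_add_two_pow_lt (ord c) (ord d) (ord a)
    have k2 := @two_pow_add_two_pow_lt (ord c) (ord d) (ord b)
    by_cases c1 : ord a < ord c ∧ ord b < ord c
    · exact ⟨c, hc, main c hc c1.1 c1.2⟩
    · have hd' : ord a < ord d ∧ ord b < ord d := by
        have := Nat.two_pow_pos (ord a)
        have := Nat.two_pow_pos (ord b)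
        rcases lt_or_gt_of_ne (h.1.ne hab.ne) with h2 | h2
        · by_cases hdb' : ord d < ord b
          · have := k2 (by omega) hdb' h1
            omega
          · omega
        · by_cases hda' : ord d < ord a
          · have := k1 (by omega) hda' h1
            omega
          · omega
      exact ⟨d, hd, main d hd hd'.1 hd'.2⟩

end Ordering

/-! ### Covers add one vertex -/

section Covers

variable {V P : Type*} [PartialOrder P] {G : SimpleGraph V} {S : P ↪o Finset V}
  {ord : V → ℕ} {x y z : P}

theorem NoIsolated.insert [DecidableEq V] {A : Finset V} (hA : NoIsolated G A) {u v : V}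
    (hu : u ∈ A) (huv : G.Adj u v) : NoIsolated G (insert v A) := by
  intro w hw
  rcases Finset.mem_insert.1 hw with rfl | hw
  · exact ⟨u, Finset.mem_insert_of_mem hu, huv.symm⟩
  · obtain ⟨t, ht, hwt⟩ := hA w hw
    exact ⟨t, Finset.mem_insert_of_mem ht, hwt⟩

theorem covBy_of_eq_insert [DecidableEq V] {v : V} (hv : v ∉ S x)
    (h : S z = insert v (S x)) : x ⋖ z := by
  have : S x ⋖ S z := by
    rw [h]
    exact Finset.covBy_insert hv
  exact ⟨S.lt_iff_lt.1 this.lt, fun c hxc hcz => this.2 (S.lt_iff_lt.2 hxc) (S.lt_iff_lt.2 hcz)⟩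

theorem exists_eq_insert_of_adj [DecidableEq V] (hS : ∀ W, W ∈ Set.range S ↔ NoIsolated G W)
    {u v : V} (hu : u ∈ S x) (huv : G.Adj u v) : ∃ z, S z = insert v (S x) :=
  (hS _).2 (((hS (S x)).1 ⟨x, rfl⟩).insert hu huv)

variable [OrderBot P]

theorem exists_adj_of_ne_bot (hS : ∀ W, W ∈ Set.range S ↔ NoIsolated G W) (hx : x ≠ ⊥) :
    ∃ a ∈ S x, ∃ b ∈ S x, G.Adj a b := by
  have : (S x).Nonempty := by
    rw [Finset.nonempty_iff_ne_empty, ← embedding_bot hS, Ne, S.injective.eq_iff]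
    exact hx
  obtain ⟨a, ha⟩ := this
  exact ⟨a, ha, (hS (S x)).1 ⟨x, rfl⟩ a ha⟩

theorem isAtom_iff_isEdge (hS : ∀ W, W ∈ Set.range S ↔ NoIsolated G W) :
    IsAtom x ↔ IsEdge G (S x) := by
  classical
  constructor
  · intro hx
    obtain ⟨a, ha, b, hb, hab⟩ := exists_adj_of_ne_bot hS hx.1
    obtain ⟨c, hc⟩ := (hS {a, b}).2 (isEdge_pair hab).noIsolated
    have hcx : c ≤ x := by
      rw [← S.le_iff_le, hc]
      simp [Finset.insert_subset_iff, ha, hb]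
    rcases hx.le_iff.1 hcx with rfl | rfl
    · rw [embedding_bot hS] at hc
      exact absurd hc.symm (Finset.insert_ne_empty _ _)
    · exact hc ▸ isEdge_pair hab
  · intro hx
    obtain ⟨a, b, hab, hx⟩ := hx.exists_eq
    refine ⟨?_, fun z hz => ?_⟩
    · rintro rfl
      rw [embedding_bot hS] at hx
      exact absurd hx.symm (Finset.insert_ne_empty _ _)
    · by_contra hne
      obtain ⟨c, hc, d, hd, hcd⟩ := exists_adj_of_ne_bot hS hne
      have h1 := Finset.card_lt_card (S.lt_iff_lt.2 hz)
      have h2 : ({c, d} : Finset V).card ≤ (S z).card :=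
        Finset.card_le_card (by simp [Finset.insert_subset_iff, hc, hd])
      rw [hx, Finset.card_pair hab.ne] at h1
      rw [Finset.card_pair hcd.ne] at h2
      omega

/-- Some vertex of `S y` outside `S x` is adjacent to `S x`: a new edge disjoint from `S x` is
linked to an edge of `S x` by `IsEliminationOrdering.exists_adj`. Adding that vertex alone stays in
the lattice, so it already gives `y`. -/
theorem exists_eq_insert_of_covBy [DecidableEq V]
    (hS : ∀ W, W ∈ Set.range S ↔ NoIsolated G W) (hord : IsEliminationOrdering G ord)
    (hx : x ≠ ⊥) (hxy : x ⋖ y) : ∃ v ∉ S x, S y = insert v (S x) := by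
  obtain ⟨a, ha, b, hb, hab⟩ := exists_adj_of_ne_bot hS hx
  obtain ⟨u, hu, v, hv, hvx, huv⟩ : ∃ u ∈ S x, ∃ v ∈ S y, v ∉ S x ∧ G.Adj u v := by
    obtain ⟨v, hv, hvx⟩ := Finset.exists_of_ssubset (S.lt_iff_lt.2 hxy.lt)
    obtain ⟨w, hw, hvw⟩ := (hS (S y)).1 ⟨y, rfl⟩ v hv
    by_cases hwx : w ∈ S x
    · exact ⟨w, hwx, v, hv, hvx, hvw.symm⟩
    · have hne : ∀ s ∈ S x, ∀ t ∉ S x, t ≠ s := fun s hs t ht e => ht (e ▸ hs)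
      rcases hord.exists_adj hab hvw (hne a ha v hvx) (hne b hb v hvx) (hne a ha w hwx)
        (hne b hb w hwx) with (h | h) | (h | h)
      · exact ⟨a, ha, v, hv, hvx, h.symm⟩
      · exact ⟨b, hb, v, hv, hvx, h.symm⟩
      · exact ⟨a, ha, w, hw, hwx, h.symm⟩
      · exact ⟨b, hb, w, hw, hwx, h.symm⟩
  obtain ⟨z, hz⟩ := exists_eq_insert_of_adj hS hu huv
  have hxz := covBy_of_eq_insert hvx hz
  have hzy : z ≤ y := by
    rw [← S.le_iff_le, hz]
    exact Finset.insert_subset hv (S.lt_iff_lt.2 hxy.lt).subset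
  rcases hxy.eq_or_eq hxz.le hzy with h | h
  · exact absurd h hxz.lt.ne'
  · exact ⟨v, hvx, h ▸ hz⟩

end Covers

/-! ### Increasing chains in intervals rooted at an atom -/

section RootedIntervals

variable {V P Λ : Type*} [PartialOrder P] [OrderBot P] {S : P ↪o Finset V}
  {x y z e : P} {r : List P}

/-- `r` is a maximal chain of `[⊥, x]` whose first edge is `⊥ ⋖ e`. -/
def IsRoot (e x : P) (r : List P) : Prop :=
  (∃ l, r = ⊥ :: e :: l) ∧ IsSaturatedChain ⊥ x r

theorem IsRoot.concat (hr : IsRoot e x r) (hxz : x ⋖ z) : IsRoot e z (r ++ [z]) := by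
  obtain ⟨⟨l, rfl⟩, h⟩ := hr
  exact ⟨⟨l ++ [z], rfl⟩, h.concat hxz⟩

theorem IsRoot.bot_covBy_and_le (hr : IsRoot e x r) : ⊥ ⋖ e ∧ e ≤ x := by
  obtain ⟨⟨l, rfl⟩, h⟩ := hr
  obtain ⟨h1, h2⟩ := isSaturatedChain_cons_cons.1 h
  exact ⟨h1, h2.le_of_cons⟩

theorem IsSaturatedChain.exists_isRoot (hr : IsSaturatedChain ⊥ x r) (hx : x ≠ ⊥) :
    ∃ e, IsRoot e x r := by
  obtain ⟨l, rfl⟩ := hr.exists_eq_cons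
  obtain ⟨e, l, rfl, -, -⟩ := hr.exists_eq_cons_cons (bot_lt_iff_ne_bot.2 hx)
  exact ⟨e, ⟨l, rfl⟩, hr⟩

/-- The chain-edge labeling which labels the edge `⊥ ⋖ e` by `atomLabel e`, and an edge `x ⋖ z` of
a chain through the atom `e` by `step e x z`. -/
def chainLabel (atomLabel : P → ℕ) (step : P → P → P → ℕ) : List P → ℕ
  | [_, e] => atomLabel e
  | _ :: e :: a :: l => step e ((e :: a :: l).dropLast.getLast?.getD e) ((a :: l).getLast?.getD e)
  | _ => 0

theorem chainLabel_concat {atomLabel : P → ℕ} {step : P → P → P → ℕ} (hr : IsRoot e x r) :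
    chainLabel atomLabel step (r ++ [z]) = step e x z := by
  obtain ⟨⟨l, rfl⟩, h⟩ := hr
  have hx := (isSaturatedChain_cons_cons.1 h).2.2.1
  have h1 : ∀ a m, l ++ [z] = a :: m →
      chainLabel atomLabel step (⊥ :: e :: (l ++ [z])) = step e x z := by
    intro a m hm
    rw [hm, chainLabel, ← hm, ← List.cons_append, List.dropLast_concat, hx, List.getLast?_concat]
    rfl
  cases l with
  | nil => exact h1 z [] rfl
  | cons a l => exact h1 a (l ++ [z]) rfl

variable [DecidableEq V] {lab : List P → ℕ} {lam : V → ℕ}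

theorem mem_labelSeq_iff
    (hcov : ∀ a b : P, a ≠ ⊥ → a ⋖ b → ∃ v ∉ S a, S b = insert v (S a))
    (hlab : ∀ (x z : P) (r : List P) (v : V), IsRoot e x r → x ⋖ z → v ∉ S x →
      S z = insert v (S x) → lab (r ++ [z]) = lam v) (m : ℕ) :
    ∀ (d : List P) (x : P) (r : List P), IsRoot e x r → IsSaturatedChain x y (x :: d) →
      (m ∈ labelSeq lab r d ↔ ∃ v ∈ S y, v ∉ S x ∧ m = lam v) := by
  intro d
  induction d with
  | nil =>
    intro x r _ hd
    obtain rfl := isSaturatedChain_singleton.1 hd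
    simp only [labelSeq, List.not_mem_nil, false_iff]
    rintro ⟨v, hv, hv', -⟩
    exact hv' hv
  | cons z d ih =>
    intro x r hr hd
    obtain ⟨hxz, hd⟩ := isSaturatedChain_cons_cons.1 hd
    obtain ⟨h1, h2⟩ := hr.bot_covBy_and_le
    obtain ⟨v, hv, hz⟩ := hcov x z (h1.lt.trans_le h2).ne' hxz
    rw [labelSeq, List.mem_cons, ih z _ (hr.concat hxz) hd, hlab x z r v hr hxz hv hz, hz]
    have hvy : v ∈ S y := S.monotone hd.le_of_cons (hz ▸ Finset.mem_insert_self _ _)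
    constructor
    · rintro (rfl | ⟨u, hu, hux, rfl⟩)
      · exact ⟨v, hvy, hv, rfl⟩
      · exact ⟨u, hu, fun h => hux (Finset.mem_insert_of_mem h), rfl⟩
    · rintro ⟨u, hu, hux, rfl⟩
      by_cases huv : u = v
      · exact Or.inl (by rw [huv])
      · exact Or.inr ⟨u, hu, by simp [huv, hux], rfl⟩

/-- Greedy argument: every chain from `x` to `y` adds the same vertices, each with its own label, so
an increasing chain must add the smallest label first, and `hfeas` makes this possible. -/
theorem exists_increasing_chain (hinj : Function.Injective lam)
    (hcov : ∀ a b : P, a ≠ ⊥ → a ⋖ b → ∃ v ∉ S a, S b = insert v (S a))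
    (hlab : ∀ (x z : P) (r : List P) (v : V), IsRoot e x r → x ⋖ z → v ∉ S x →
      S z = insert v (S x) → lab (r ++ [z]) = lam v)
    (hfeas : ∀ x v, e ≤ x → v ∈ S y → v ∉ S x → (∀ u ∈ S y, u ∉ S x → lam v ≤ lam u) →
      ∃ z, S z = insert v (S x)) :
    ∀ (n : ℕ) (x : P) (r : List P), (S y \ S x).card = n → IsRoot e x r → x ≤ y →
      ∃ d, IsSaturatedChain x y (x :: d) ∧ (labelSeq lab r d).IsChain (· ≤ ·) ∧
        ∀ d', IsSaturatedChain x y (x :: d') → d' ≠ d →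
          ¬ (labelSeq lab r d').IsChain (· ≤ ·) ∧
          List.Lex (· < ·) (labelSeq lab r d) (labelSeq lab r d') := by
  intro n
  induction n with
  | zero =>
    intro x r hn _ hxy
    have : x = y := by
      refine le_antisymm hxy (S.le_iff_le.1 ?_)
      rwa [Finset.card_eq_zero, Finset.sdiff_eq_empty_iff_subset] at hn
    subst this
    exact ⟨[], isSaturatedChain_singleton.2 rfl, by simp [labelSeq],
      fun d' hd' hne => absurd hd'.eq_nil hne⟩
  | succ n ih =>
    intro x r hn hr hxy
    obtain ⟨v, hv, hmin⟩ := Finset.exists_min_image (S y \ S x) lam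
      (Finset.card_pos.1 (by omega))
    rw [Finset.mem_sdiff] at hv
    have hmin' : ∀ u ∈ S y, u ∉ S x → lam v ≤ lam u := fun u hu hux =>
      hmin u (Finset.mem_sdiff.2 ⟨hu, hux⟩)
    obtain ⟨z, hz⟩ := hfeas x v hr.bot_covBy_and_le.2 hv.1 hv.2 hmin'
    have hxz := covBy_of_eq_insert hv.2 hz
    have hzy : z ≤ y := by
      rw [← S.le_iff_le, hz]
      exact Finset.insert_subset hv.1 (S.monotone hxy)
    have hlz : lab (r ++ [z]) = lam v := hlab x z r v hr hxz hv.2 hz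
    have hcard : (S y \ S z).card = n := by
      rw [hz, Finset.sdiff_insert, Finset.card_erase_of_mem (Finset.mem_sdiff.2 hv), hn]
      rfl
    obtain ⟨d, hd, hinc, huniq⟩ := ih z (r ++ [z]) hcard (hr.concat hxz) hzy
    refine ⟨z :: d, isSaturatedChain_cons_cons.2 ⟨hxz, hd⟩, ?_, fun d' hd' hne => ?_⟩
    · rw [labelSeq, List.isChain_iff_pairwise, List.pairwise_cons]
      refine ⟨fun m hm => ?_, List.isChain_iff_pairwise.1 hinc⟩
      obtain ⟨u, hu, hux, rfl⟩ := (mem_labelSeq_iff hcov hlab m d z _ (hr.concat hxz) hd).1 hm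
      rw [hlz]
      exact hmin' u hu fun h => hux (hz ▸ Finset.mem_insert_of_mem h)
    · obtain ⟨w, d', rfl, hxw, hd'⟩ := hd'.exists_eq_cons_cons (hxz.lt.trans_le hzy)
      by_cases hwz : w = z
      · subst hwz
        obtain ⟨h1, h2⟩ := huniq d' hd' fun h => hne (by rw [h])
        exact ⟨fun h => h1 (by rw [labelSeq] at h; exact h.tail), List.Lex.cons h2⟩
      · obtain ⟨h1, h2⟩ := hr.bot_covBy_and_le
        obtain ⟨u, hu, hw⟩ := hcov x w (h1.lt.trans_le h2).ne' hxw
        have huv : v ≠ u := by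
          rintro rfl
          exact hwz (S.injective (hw.trans hz.symm))
        have huy : u ∈ S y := S.monotone hd'.le_of_cons (hw ▸ Finset.mem_insert_self _ _)
        have hlt : lam v < lam u := lt_of_le_of_ne (hmin' u huy hu) (hinj.ne huv)
        have hlw : lab (r ++ [w]) = lam u := hlab x w r u hr hxw hu hw
        refine ⟨fun h => ?_, List.Lex.rel (by rw [hlz, hlw]; exact hlt)⟩
        rw [labelSeq, List.isChain_iff_pairwise, List.pairwise_cons, hlw] at h
        -- A chain starting with `u ≠ v` still has to add `v` later, with a smaller label.
        refine hlt.not_ge (h.1 _ ?_)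
        rw [mem_labelSeq_iff hcov hlab _ d' w _ (hr.concat hxw) hd']
        exact ⟨v, hv.1, by simp [hw, huv, hv.2], rfl⟩

end RootedIntervals

/-! ### The CL-labeling of a co-chordal graph -/

section Labeling

variable {V P : Type*} [Fintype V] {G : SimpleGraph V} {ord : V → ℕ}

/-- A strict upper bound for the weights of all sets of vertices. -/
def weightBound (ord : V → ℕ) : ℕ := 1 + ∑ v, 2 ^ ord v

theorem weight_lt_weightBound (e : Finset V) : weight ord e < weightBound ord := by
  have := Finset.sum_le_sum_of_subset (f := fun v => 2 ^ ord v) (Finset.subset_univ e)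
  rw [weight, weightBound]
  omega

theorem ord_lt_weightBound (v : V) : ord v < weightBound ord := by
  have h1 := weight_lt_weightBound (ord := ord) {v}
  rw [weight, Finset.sum_singleton] at h1
  exact Nat.lt_two_pow_self.trans h1

open Classical in
/-- The label of the vertex `v` in chains through the edge `e`: first come the vertices which
create an edge preceding `e`, then the other vertices adjacent to `e`, then the rest. -/
noncomputable def vertexLabel (G : SimpleGraph V) (ord : V → ℕ) (e : Finset V) (v : V) : ℕ :=
  if IsEarly G ord e v then ord v
  else if ∃ u ∈ e, G.Adj u v then 2 * weightBound ord + ord v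
  else 3 * weightBound ord + ord v

theorem vertexLabel_injective (h : Function.Injective ord) (e : Finset V) :
    Function.Injective (vertexLabel G ord e) := by
  intro u v huv
  have := ord_lt_weightBound (ord := ord) u
  have := ord_lt_weightBound (ord := ord) v
  refine h ?_
  unfold vertexLabel at huv
  split_ifs at huv <;> omega

theorem IsEarly.vertexLabel_lt {e : Finset V} {v : V} (h : IsEarly G ord e v) :
    vertexLabel G ord e v < weightBound ord := by
  rw [vertexLabel, if_pos h]
  exact ord_lt_weightBound v

theorem le_vertexLabel {e : Finset V} {v : V} (h : ¬ IsEarly G ord e v) :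
    2 * weightBound ord ≤ vertexLabel G ord e v := by
  rw [vertexLabel, if_neg h]
  split_ifs <;> omega

variable [PartialOrder P] {S : P ↪o Finset V}

/-- If `v` has no neighbour in `S x`, it has a neighbour `w` in `S y` outside `S x`. Minimality of
the label of `v`, which lies in the last group, keeps `w` from being adjacent to `e`. Then `e` and
`{v, w}` are disjoint edges with no edge between them. -/
theorem exists_eq_insert_of_vertexLabel_le [DecidableEq V]
    (hS : ∀ W, W ∈ Set.range S ↔ NoIsolated G W) (hord : IsEliminationOrdering G ord)
    {x y e : P} (he : IsEdge G (S e)) {v : V} (hex : e ≤ x) (hv : v ∈ S y)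
    (hvx : v ∉ S x)
    (hmin : ∀ u ∈ S y, u ∉ S x → vertexLabel G ord (S e) v ≤ vertexLabel G ord (S e) u) :
    ∃ z, S z = insert v (S x) := by
  by_cases hadj : ∃ u ∈ S x, G.Adj u v
  · obtain ⟨u, hu, huv⟩ := hadj
    exact exists_eq_insert_of_adj hS hu huv
  · exfalso
    push Not at hadj
    have hsub := S.monotone hex
    obtain ⟨w, hw, hvw⟩ := (hS (S y)).1 ⟨y, rfl⟩ v hv
    have hwx : w ∉ S x := fun h => hadj w h hvw.symm
    have hv' : ¬ ∃ u ∈ S e, G.Adj u v := fun ⟨u, hu, huv⟩ => hadj u (hsub hu) huv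
    have hw' : ¬ ∃ u ∈ S e, G.Adj u w := by
      intro h
      have h1 := hmin w hw hwx
      have := ord_lt_weightBound (ord := ord) w
      rw [vertexLabel, if_neg fun h => hv' h.exists_adj, if_neg hv', vertexLabel, if_pos h] at h1
      split_ifs at h1 <;> omega
    obtain ⟨a, b, hab, hE⟩ := he.exists_eq
    have ha : a ∈ S e := by simp [hE]
    have hb : b ∈ S e := by simp [hE]
    have hne : ∀ s ∈ S e, ∀ t ∉ S x, t ≠ s := fun s hs t ht h => ht (h ▸ hsub hs)
    rcases hord.exists_adj hab hvw (hne a ha v hvx) (hne b hb v hvx) (hne a ha w hwx)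
      (hne b hb w hwx) with (h | h) | (h | h)
    · exact hv' ⟨a, ha, h.symm⟩
    · exact hv' ⟨b, hb, h.symm⟩
    · exact hw' ⟨a, ha, h.symm⟩
    · exact hw' ⟨b, hb, h.symm⟩

variable [OrderBot P]

/-- The CL-labeling of the lcm-lattice of a co-chordal graph. -/
noncomputable def edgeIdealLabel [DecidableEq V] (S : P ↪o Finset V) (G : SimpleGraph V)
    (ord : V → ℕ) : List P → ℕ :=
  -- With `B = weightBound ord`, atom labels lie in `(B, 2B]`, early vertices have labels below `B`,
  -- and the other vertices have labels at least `2B`. The sum below has one term whenever a single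
  -- vertex is added.
  chainLabel (fun e => 2 * weightBound ord - weight ord (S e))
    fun e x z => ∑ v ∈ S z \ S x, vertexLabel G ord (S e) v

theorem edgeIdealLabel_concat [DecidableEq V] {e x z : P} {r : List P} {v : V}
    (hr : IsRoot e x r) (hv : v ∉ S x) (hz : S z = insert v (S x)) :
    edgeIdealLabel S G ord (r ++ [z]) = vertexLabel G ord (S e) v := by
  rw [edgeIdealLabel, chainLabel_concat hr, hz, Finset.insert_sdiff_of_notMem _ hv, sdiff_self]
  exact Finset.sum_singleton _ _

theorem isCLLabeling_edgeIdealLabel [DecidableEq V]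
    (hS : ∀ W, W ∈ Set.range S ↔ NoIsolated G W) (hord : IsEliminationOrdering G ord) :
    IsCLLabeling (edgeIdealLabel S G ord) := by
  have hcov : ∀ a b : P, a ≠ ⊥ → a ⋖ b → ∃ v ∉ S a, S b = insert v (S a) :=
    fun a b => exists_eq_insert_of_covBy hS hord
  have hedge : ∀ {e : P}, ⊥ ⋖ e → IsEdge G (S e) := fun h =>
    (isAtom_iff_isEdge hS).1 (bot_covBy_iff.1 h)
  have hmem := fun e y => mem_labelSeq_iff (S := S) (e := e) (y := y)
    (lab := edgeIdealLabel S G ord) hcov fun x z r v hr _ hv hz => edgeIdealLabel_concat hr hv hz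
  have hroot := fun {x y e : P} {r : List P} (hr : IsRoot e x r) (hxy : x ≤ y) =>
    exists_increasing_chain (S := S) (e := e) (y := y) (lab := edgeIdealLabel S G ord)
      (vertexLabel_injective hord.1 _) hcov
      (fun x z r v hr _ hv hz => edgeIdealLabel_concat hr hv hz)
      (fun x v hex hv hvx hmin => exists_eq_insert_of_vertexLabel_le hS hord
        (hedge hr.bot_covBy_and_le.1) hex hv hvx hmin) _ x r rfl hr hxy
  intro x y r hxy hr
  by_cases hx : x = ⊥
  · subst hx
    obtain ⟨l, rfl⟩ := hr.exists_eq_cons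
    obtain rfl := hr.eq_nil
    have hatom : ∀ e : P, edgeIdealLabel S G ord ([⊥] ++ [e]) =
      2 * weightBound ord - weight ord (S e) := fun e => rfl
    have hroot1 : ∀ {e : P}, ⊥ ⋖ e → IsRoot e e ([⊥] ++ [e]) := fun h =>
      ⟨⟨[], rfl⟩, hr.concat h⟩
    have hfin : {e : P | ⊥ ⋖ e ∧ e ≤ y}.Finite :=
      (Set.toFinite _).preimage S.injective.injOn (s := Set.univ) |>.subset (Set.subset_univ _)
    obtain ⟨e₁, he₁, he₁y⟩ : ∃ e, ⊥ ⋖ e ∧ e ≤ y := by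
      obtain ⟨a, ha, b, hb, hab⟩ := exists_adj_of_ne_bot hS hxy.ne'
      obtain ⟨e, he⟩ := (hS {a, b}).2 (isEdge_pair hab).noIsolated
      refine ⟨e, bot_covBy_iff.2 ((isAtom_iff_isEdge hS).2 (he ▸ isEdge_pair hab)), ?_⟩
      rw [← S.le_iff_le, he]
      simp [Finset.insert_subset_iff, ha, hb]
    -- The heaviest edge inside `S y` has the smallest atom label. No vertex of `S y` is early for
    -- it, since that would give a heavier edge inside `S y`.
    obtain ⟨e, ⟨he, hey⟩, hmax⟩ := Set.exists_max_image _ (fun e => weight ord (S e)) hfin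
      ⟨e₁, he₁, he₁y⟩
    obtain ⟨d, hd, hinc, huniq⟩ := hroot (hroot1 he) hey
    refine ⟨⊥ :: e :: d, isSaturatedChain_cons_cons.2 ⟨he, hd⟩, ?_, fun c' hc' hne => ?_⟩
    · rw [List.tail_cons, labelSeq, List.isChain_iff_pairwise, List.pairwise_cons, hatom]
      refine ⟨fun m hm => ?_, List.isChain_iff_pairwise.1 hinc⟩
      obtain ⟨v, hv, hve, rfl⟩ := (hmem e y m d e _ (hroot1 he) hd).1 hm
      refine (Nat.sub_le _ _).trans (le_vertexLabel ?_)
      rintro ⟨-, l, hl, hsub, hw⟩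
      obtain ⟨f, hf⟩ := (hS l).2 hl.noIsolated
      subst hf
      refine hw.not_ge (hmax f ⟨bot_covBy_iff.2 ((isAtom_iff_isEdge hS).2 hl), ?_⟩)
      rw [← S.le_iff_le]
      intro u hu
      rcases hsub u hu with rfl | hu
      · exact hv
      · exact S.monotone hey hu
    · obtain ⟨c', rfl⟩ := hc'.exists_eq_cons
      obtain ⟨f, d', rfl, hf, hd'⟩ := hc'.exists_eq_cons_cons hxy
      simp only [List.tail_cons, labelSeq]
      by_cases hfe : f = e
      · subst hfe
        obtain ⟨h1, h2⟩ := huniq d' hd' fun h => hne (by rw [h])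
        exact ⟨fun h => h1 h.tail, List.Lex.cons h2⟩
      · have hfy := hd'.le_of_cons
        have hw : weight ord (S f) < weight ord (S e) :=
          lt_of_le_of_ne (hmax f ⟨hf, hfy⟩) fun h =>
            hfe (S.injective (weight_injective hord.1 h))
        have h1 := weight_lt_weightBound (ord := ord) (S e)
        refine ⟨fun h => ?_, List.Lex.rel (by rw [hatom, hatom]; omega)⟩
        -- Starting from a lighter edge `f`, linear quotients give a vertex of `e` early for `f`. It
        -- is added later with label below `B`, under the label of `f`.
        obtain ⟨v, hve, hv⟩ := hord.exists_isEarly (hedge he) (hedge hf) hw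
        rw [List.isChain_iff_pairwise, List.pairwise_cons, hatom] at h
        have h2 := h.1 _ ((hmem f y _ d' f _ (hroot1 hf) hd').2
          ⟨v, S.monotone hey hve, hv.1, rfl⟩)
        have h3 := hv.vertexLabel_lt
        omega
  · obtain ⟨e, he⟩ := hr.exists_isRoot hx
    obtain ⟨d, hd, hinc, huniq⟩ := hroot he hxy.le
    refine ⟨x :: d, hd, hinc, fun c' hc' hne => ?_⟩
    obtain ⟨d', rfl⟩ := hc'.exists_eq_cons
    exact huniq d' hc' fun h => hne (by rw [h])

end Labeling

end CLShell

theorem corollary3 {V : Type*} [Finite V] (G : SimpleGraph V) (k : Type*) [Field k] :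
    CLShell.IsCochordal G ↔
      (CLShell.IsDegreeGraded (CLShell.edgeIdeal k G) 2 ∧
        CLShell.IsCLShellable (CLShell.lcmLattice (CLShell.edgeIdeal k G))) := by
  classical
  have := Fintype.ofFinite V
  have hS : ∀ W, W ∈ Set.range (CLShell.supportEmbedding k G) ↔ CLShell.NoIsolated G W :=
    fun W => CLShell.mem_range_supportEmbedding
  have hfin : Finite (CLShell.lcmLattice (CLShell.edgeIdeal k G)) :=
    (CLShell.lcmLattice_finite _).to_subtype
  have := Fintype.ofFinite (CLShell.lcmLattice (CLShell.edgeIdeal k G))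
  constructor
  · intro hG
    obtain ⟨ord, hord⟩ := hG.exists_ordering
    have hcov : ∀ a b : CLShell.lcmLattice (CLShell.edgeIdeal k G), a ≠ ⊥ → a ⋖ b →
        (b : V →₀ ℕ).degree = (a : V →₀ ℕ).degree + 1 := by
      intro a b ha hab
      obtain ⟨v, hv, hb⟩ := CLShell.exists_eq_insert_of_covBy hS hord ha hab
      rw [← CLShell.card_supportEmbedding, ← CLShell.card_supportEmbedding, hb,
        Finset.card_insert_of_notMem hv]
    have hatom : ∀ a : CLShell.lcmLattice (CLShell.edgeIdeal k G), IsAtom a →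
        (a : V →₀ ℕ).degree = 2 := by
      intro a ha
      obtain ⟨p, q, hpq, h⟩ := ((CLShell.isAtom_iff_isEdge hS).1 ha).exists_eq
      rw [← CLShell.card_supportEmbedding, h, Finset.card_pair hpq.ne]
    have hdbot : ((⊥ : CLShell.lcmLattice (CLShell.edgeIdeal k G)) : V →₀ ℕ).degree = 0 := by
      rw [← CLShell.card_supportEmbedding, CLShell.embedding_bot hS, Finset.card_empty]
    refine ⟨⟨fun a b ha _ => hcov a b ha, hatom⟩,
      -- Degree minus one, truncated at `⊥`, is a rank function because atoms have degree `2`.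
      CLShell.isGraded_of_rank (ρ := fun a => (a : V →₀ ℕ).degree - 1) ?_ ?_, ℕ, inferInstance,
      _, CLShell.isCLLabeling_edgeIdealLabel hS hord⟩
    · intro a b hab
      by_cases ha : a = ⊥
      · subst ha
        have := hatom b (bot_covBy_iff.1 hab)
        simp only [hdbot, this]
      · have h1 := hcov a b ha hab
        obtain ⟨v, hv, -⟩ := CLShell.exists_adj_of_ne_bot hS ha
        have h2 := Finset.card_pos.2 ⟨v, hv⟩
        rw [CLShell.card_supportEmbedding] at h2
        simp only [h1]
        omega
    · simp only [hdbot]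
  · rintro ⟨⟨hcov, hatom⟩, -, Λ, _, lab, hlab⟩
    refine CLShell.isCochordal_of_isCLLabeling hS (fun a b ha hab => ?_) (fun a ha => ?_) hlab
    · rw [CLShell.card_supportEmbedding, CLShell.card_supportEmbedding]
      exact hcov a b ha (bot_lt_iff_ne_bot.1 (bot_le.trans_lt hab.lt)) hab
    · rw [CLShell.card_supportEmbedding]
      exact hatom a ha
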